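/- \textbf{Definitions.} For an ordinal $\kappa$, a set $S\subseteq\kappa$ is \emph{$\Pi^1_n$-indescribable} (in $\kappa$) if for every $A\subseteq V_\kappa$ and every $\Pi^1_n$-sentence $\varphi$ with $(V_\kappa,\in,A)\models\varphi$ there is $\alpha\in S$ with $(V_\alpha,\in,A\cap V_\alpha)\models\varphi$; $\kappa$ is $\Pi^1_n$-indescribable if $\kappa$ is a $\Pi^1_n$-indescribable subset of itself (such $\kappa$ is then automatically an inaccessible cardinal). Let $n\ge 1$. A set $C\subseteq\kappa$ is an \emph{$n$-club} subset of $\kappa$ if $C$ is $\Pi^1_{n-1}$-indescribable in $\kappa$ and contains every $\alpha<\kappa$ such that $C\cap\alpha$ is $\Pi^1_{n-1}$-indescribable in $\alpha$. Let $\mathrm{Tr}_{n-1}(\kappa)$ be the set of all $\Pi^1_{n-1}$-indescribable $\alpha<\kappa$. The principle $\square_n(\kappa)$ says that $\mathrm{Tr}_{n-1}(\kappa)$ is cofinal in $\kappa$ and there is a sequence $\langle C_\alpha:\alpha\in\mathrm{Tr}_{n-1}(\kappa)\rangle$ such that \begin{enumerate} \item each $C_\alpha$ is an $n$-club subset of $\alpha$;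 \item for all $\alpha<\beta$ in $\mathrm{Tr}_{n-1}(\kappa)$, if $C_\beta\cap\alpha$ is $\Pi^1_{n-1}$-indescribable in $\alpha$, then $C_\alpha=C_\beta\cap\alpha$; \item there is no $n$-club $C\subseteq\kappa$ such that for all $\alpha\in\mathrm{Tr}_{n-1}(\kappa)$, if $C\cap\alpha$ is $\Pi^1_{n-1}$-indescribable in $\alpha$, then $C_\alpha=C\cap\alpha$. \end{enumerate} \textbf{Theorem.} Suppose that $1\le n<\omega$, $\kappa$ is $\Pi^1_n$-indescribable and $\square_n(\kappa)$ holds. Then there are two distinct $\Pi^1_n$-indescribable sets $S_0,S_1\subseteq\kappa$ that do not reflect simultaneously, i.e. there is no $\beta<\kappa$ such that $S_0\cap\beta$ and $S_1\cap\beta$ are both $\Pi^1_n$-indescribable subsets of $\beta$. -/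

import Mathlib

universe u

namespace Indescribable

open ZFSet

/-- First-order formulas of the language with equality, a binary symbol `∈`, and `k` unary
predicate symbols (set variables), with `m` free first-order variables. Variables are de Bruijn
indices: a quantifier binds the variable `0` of its body. -/
inductive FOFormula (k : ℕ) : ℕ → Type
  | eq {m : ℕ} (i j : Fin m) : FOFormula k m
  | mem {m : ℕ} (i j : Fin m) : FOFormula k m
  | inSet {m : ℕ} (i : Fin m) (X : Fin k) : FOFormula k m
  | neg {m : ℕ} (φ : FOFormula k m) : FOFormula k m
  | and {m : ℕ} (φ ψ : FOFormula k m) : FOFormula k m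
  | all {m : ℕ} (φ : FOFormula k (m + 1)) : FOFormula k m

/-- Satisfaction of a first-order formula in `(M, ∈, s 0, …, s (k - 1))` under the assignment `e`
of the first-order variables. Quantifiers range over the elements of `M`. -/
def FOFormula.Sat {k : ℕ} (M : ZFSet.{u}) (s : Fin k → Set ZFSet.{u}) :
    {m : ℕ} → FOFormula k m → (Fin m → ZFSet.{u}) → Prop
  | _, .eq i j, e => e i = e j
  | _, .mem i j, e => e i ∈ e j
  | _, .inSet i X, e => e i ∈ s X
  | _, .neg φ, e => ¬ φ.Sat M s e
  | _, .and φ ψ, e => φ.Sat M s e ∧ ψ.Sat M s e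
  | _, .all φ, e => ∀ x ∈ M, φ.Sat M s (Fin.cons x e)

/-- Prenex second-order formulas with `k` free set variables and no free first-order variable:
a string of set quantifiers in front of a first-order matrix. A set quantifier binds the set
variable `0` of its body. -/
inductive SOFormula : ℕ → Type
  | matrix {k : ℕ} (φ : FOFormula k 0) : SOFormula k
  | all {k : ℕ} (φ : SOFormula (k + 1)) : SOFormula k
  | ex {k : ℕ} (φ : SOFormula (k + 1)) : SOFormula k

/-- Satisfaction in `(M, ∈, s 0, …, s (k - 1))`, with the set quantifiers ranging over all subsets
of `M` (full second-order semantics). -/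
def SOFormula.Sat (M : ZFSet.{u}) : {k : ℕ} → SOFormula k → (Fin k → Set ZFSet.{u}) → Prop
  | _, .matrix φ, s => φ.Sat M s Fin.elim0
  | _, .all φ, s => ∀ X : Set ZFSet.{u}, X ⊆ {x | x ∈ M} → φ.Sat M (Fin.cons X s)
  | _, .ex φ, s => ∃ X : Set ZFSet.{u}, X ⊆ {x | x ∈ M} ∧ φ.Sat M (Fin.cons X s)

/-- The two kinds of levels of the second-order hierarchy: `Π¹ₙ` and `Σ¹ₙ`. -/
inductive Side
  | pi
  | sigma

/-- The other kind. -/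
def Side.dual : Side → Side
  | .pi => .sigma
  | .sigma => .pi

/-- `HasLevel .pi n φ` says that `φ` is a `Π¹ₙ` formula: at most `n` alternating blocks of set
quantifiers, the outermost block being universal, in front of a first-order matrix.
`HasLevel .sigma n φ` says that `φ` is a `Σ¹ₙ` formula, where the outermost block is existential.
Blocks may have any finite length, including zero. -/
inductive HasLevel : Side → ℕ → {k : ℕ} → SOFormula k → Prop
  | matrix {b : Side} {k : ℕ} (φ : FOFormula k 0) : HasLevel b 0 (SOFormula.matrix φ)
  | dual {b : Side} {n k : ℕ} {φ : SOFormula k} (h : HasLevel b.dual n φ) : HasLevel b (n + 1) φ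
  | all {n k : ℕ} {φ : SOFormula (k + 1)} (h : HasLevel .pi (n + 1) φ) :
      HasLevel .pi (n + 1) (SOFormula.all φ)
  | ex {n k : ℕ} {φ : SOFormula (k + 1)} (h : HasLevel .sigma (n + 1) φ) :
      HasLevel .sigma (n + 1) (SOFormula.ex φ)

/-- `(V_α, ∈, A ∩ V_α) ⊨ φ`, for a second-order sentence `φ` in the language of set theory with one
additional unary predicate symbol. -/
def Models (α : Ordinal.{u}) (A : Set ZFSet.{u}) (φ : SOFormula 1) : Prop :=
  φ.Sat (V_ α) (fun _ => A ∩ {x | x ∈ V_ α})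

/-- `S` is a `Π¹ₙ`-indescribable subset of `κ`. -/
def IsIndescribable (n : ℕ) (κ : Ordinal.{u}) (S : Set Ordinal.{u}) : Prop :=
  S ⊆ Set.Iio κ ∧
    ∀ A : Set ZFSet.{u}, A ⊆ {x | x ∈ V_ κ} → ∀ φ : SOFormula 1, HasLevel .pi n φ →
      Models κ A φ → ∃ α ∈ S, Models α A φ

/-- `κ` is `Π¹ₙ`-indescribable, i.e. it is a `Π¹ₙ`-indescribable subset of itself. -/
def IsIndescribableCardinal (n : ℕ) (κ : Ordinal.{u}) : Prop :=
  IsIndescribable n κ (Set.Iio κ)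

/-- `S` is a `Π¹ₙ₋₁`-indescribable subset of `κ`, where a `Π¹₋₁`-indescribable subset of a
limit ordinal is an unbounded subset (and ordinals that are not limits have none). -/
def IsPredIndescribable : ℕ → Ordinal.{u} → Set Ordinal.{u} → Prop
  | 0, κ, S => Order.IsSuccLimit κ ∧ S ⊆ Set.Iio κ ∧ ∀ a < κ, ∃ b ∈ S, a < b
  | n + 1, κ, S => IsIndescribable n κ S

/-- `Tr_{n-1}(κ)`: the set of `Π¹ₙ₋₁`-indescribable ordinals below `κ`. -/
def predTrace (n : ℕ) (κ : Ordinal.{u}) : Set Ordinal.{u} :=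
  {α | α < κ ∧ IsPredIndescribable n α (Set.Iio α)}

/-- `C` is an `n`-club subset of `κ`: it is `Π¹ₙ₋₁`-indescribable in `κ`, and it is `n`-closed, i.e.
it contains every `α < κ` such that `C ∩ α` is `Π¹ₙ₋₁`-indescribable in `α`. -/
def IsNClub (n : ℕ) (κ : Ordinal.{u}) (C : Set Ordinal.{u}) : Prop :=
  IsPredIndescribable n κ C ∧
    ∀ α < κ, IsPredIndescribable n α (C ∩ Set.Iio α) → α ∈ C

/-- `⟨C α : α ∈ Tr_{n-1}(κ)⟩` is a coherent sequence of `n`-clubs. (Values of `C` at other ordinals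
are irrelevant.) -/
structure IsCoherentSeq (n : ℕ) (κ : Ordinal.{u}) (C : Ordinal.{u} → Set Ordinal.{u}) : Prop where
  isNClub : ∀ α ∈ predTrace n κ, IsNClub n α (C α)
  coherent : ∀ α ∈ predTrace n κ, ∀ β ∈ predTrace n κ, α < β →
    IsPredIndescribable n α (C β ∩ Set.Iio α) → C α = C β ∩ Set.Iio α

/-- `D` is a thread through the sequence `⟨C α : α ∈ Tr_{n-1}(κ)⟩`. -/
def IsThread (n : ℕ) (κ : Ordinal.{u}) (C : Ordinal.{u} → Set Ordinal.{u})
    (D : Set Ordinal.{u}) : Prop :=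
  IsNClub n κ D ∧ ∀ α ∈ predTrace n κ,
    IsPredIndescribable n α (D ∩ Set.Iio α) → C α = D ∩ Set.Iio α

/-- The principle `□ₙ(κ)`: `Tr_{n-1}(κ)` is cofinal in `κ`, and there is a coherent sequence of
`n`-clubs indexed by it that has no thread. -/
def Square (n : ℕ) (κ : Ordinal.{u}) : Prop :=
  (∀ a < κ, ∃ α ∈ predTrace n κ, a ≤ α) ∧
    ∃ C : Ordinal.{u} → Set Ordinal.{u}, IsCoherentSeq n κ C ∧ ¬ ∃ D, IsThread n κ C D

end Indescribable

/-!
If `C` is a `□ₙ(κ)`-sequence, the two sets wanted are, for a suitable `α < κ`, the set of the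
indices `β > α` with `α ∈ C β` and the set of those with `α ∉ C β` (`splitPart`). They never
reflect simultaneously: if either of them reflects to `β`, it contains some `γ` with `C γ = C β ∩
γ`, so that whether `α ∈ C β` is settled by that set (`IsCoherentSeq.mem_iff_of_reflects`). If for
every `α` one of the two sets failed to be `Π¹ₙ`-indescribable, then by normality of the
indescribability ideal almost every `β` would satisfy `C β = D ∩ β` for one fixed set `D`, and `D`
would be a thread (`IsCoherentSeq.exists_isThread`).

This rests on two facts about `Π¹ₙ` with `n = m + 1`: diagonal intersections of `Π¹ₙ` properties
are `Π¹ₙ`, and `Π¹ₘ`-indescribability is a `Π¹ₙ` property. Usually both are derived from a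
universal `Π¹ₙ` formula. Here truth definitions are avoided by a semantic normal form. Call `δ < γ`
a closure point of a total relation `F` on `V_ γ` if `V_ δ` is closed under `F`; the closure points
of all such `F` generate a filter on `γ` (`clubFilter`). By a Löwenheim–Skolem argument, a
first-order statement about `V_ γ` and some of its subsets is reflected by almost every `δ`
(`FOFormula.eventually_sat_iff`). If the filter is proper, which is itself a `Π¹₁` property of `γ`
and holds whenever `γ` has an indescribable subset, then "for almost every `δ`" and "for positively
many `δ`" say the same of such a statement, and one of the two quantifiers over `F` can be merged
into the last block of set quantifiers. So a `Π¹ₙ` formula amounts to `n` alternating set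
quantifiers followed by a condition `E` on the restrictions of the sets to `V_ δ` (`Nf`,
`HasLevel.semDef`). Conversely, whatever the condition `E` is, coded as a subset of `V_ γ` it can
serve as the predicate of a fixed `Π¹ₙ` formula (`exists_models_iff_nf`). Parameters, pairing
functions for the contraction of quantifiers, and truth at smaller ordinals are thereby all
absorbed into `E`, which makes the two facts straightforward (`SemDef.forall_lt`,
`semDef_isIndescribable`).
-/

namespace Indescribable

open ZFSet Order Filter

/-! ### The filter of closure points -/

/-- The class of elements of `V_ α`. -/
def lv (α : Ordinal.{u}) : Set ZFSet.{u} := {x | x ∈ V_ α}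

theorem mem_lv {α : Ordinal.{u}} {x : ZFSet.{u}} : x ∈ lv α ↔ rank x < α := mem_vonNeumann

theorem lv_mono {α β : Ordinal.{u}} (h : α ≤ β) : lv α ⊆ lv β :=
  fun _ hx => mem_lv.2 ((mem_lv.1 hx).trans_le h)

theorem inter_lv_inter_lv {δ γ : Ordinal.{u}} (h : δ ≤ γ) (X : Set ZFSet.{u}) :
    X ∩ lv γ ∩ lv δ = X ∩ lv δ := by
  rw [Set.inter_assoc, Set.inter_eq_right.2 (lv_mono h)]

theorem rank_lt_rank_pair_left (x y : ZFSet.{u}) : rank x < rank (pair x y) :=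
  (rank_lt_of_mem (mem_singleton.2 rfl)).trans
    (rank_lt_of_mem (show {x} ∈ pair x y by simp [pair]))

theorem rank_lt_rank_pair_right (x y : ZFSet.{u}) : rank y < rank (pair x y) :=
  (rank_lt_of_mem (show y ∈ ({x, y} : ZFSet) by simp)).trans
    (rank_lt_of_mem (show {x, y} ∈ pair x y by simp [pair]))

theorem pair_mem_lv {γ : Ordinal.{u}} (hγ : IsSuccLimit γ) {x y : ZFSet.{u}} :
    pair x y ∈ lv γ ↔ x ∈ lv γ ∧ y ∈ lv γ := by
  simp only [mem_lv]
  refine ⟨fun h => ⟨(rank_lt_rank_pair_left x y).trans h,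
    (rank_lt_rank_pair_right x y).trans h⟩, fun ⟨hx, hy⟩ => ?_⟩
  simp only [pair, rank_insert, rank_singleton]
  exact max_lt (hγ.succ_lt (hγ.succ_lt hx))
    (hγ.succ_lt (max_lt (hγ.succ_lt hx) (hγ.succ_lt hy)))

/-- `F`, read as a set of ordered pairs, relates every element of `V_ α` to some element of
`V_ α`. -/
def RelClosed (F : Set ZFSet.{u}) (α : Ordinal.{u}) : Prop :=
  ∀ x ∈ lv α, ∃ y ∈ lv α, pair x y ∈ F

/-- The filter on the ordinals below a limit ordinal `γ` generated by the sets of those nonzero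
`δ < γ` for which `V_ δ` is closed under `F`, where `F ⊆ V_ γ` is a total relation on `V_ γ`. At
an inaccessible `γ` this is the club filter. It is the improper filter when `γ` is not a limit. -/
def clubFilter (γ : Ordinal.{u}) : Filter Ordinal.{u} where
  sets := {U | IsSuccLimit γ → ∃ F ⊆ lv γ, RelClosed F γ ∧
    ∀ δ < γ, 0 < δ → RelClosed F δ → δ ∈ U}
  univ_sets hγ := ⟨lv γ, subset_rfl,
    fun x hx => ⟨x, hx, (pair_mem_lv hγ).2 ⟨hx, hx⟩⟩, fun _ _ _ _ => trivial⟩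
  sets_of_superset h hUV hγ := by
    obtain ⟨F, hF, hc, hU⟩ := h hγ
    exact ⟨F, hF, hc, fun δ h1 h2 h3 => hUV (hU δ h1 h2 h3)⟩
  inter_sets := by
    intro U V hU hV hγ
    obtain ⟨F, hF, hFc, hU⟩ := hU hγ
    obtain ⟨G, hG, hGc, hV⟩ := hV hγ
    -- The relation of `x` to the pairs `(y, z)` with `F x y` and `G x z`: its closure points are
    -- closure points of both `F` and `G`.
    refine ⟨{p | p ∈ lv γ ∧ ∃ x y z, p = pair x (pair y z) ∧ pair x y ∈ F ∧ pair x z ∈ G},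
      fun p hp => hp.1, fun x hx => ?_, fun δ hδ h0 hc => ⟨hU δ hδ h0 ?_, hV δ hδ h0 ?_⟩⟩
    · obtain ⟨y, hy, hxy⟩ := hFc x hx
      obtain ⟨z, hz, hxz⟩ := hGc x hx
      have hyz := (pair_mem_lv hγ).2 ⟨hy, hz⟩
      exact ⟨pair y z, hyz, (pair_mem_lv hγ).2 ⟨hx, hyz⟩, x, y, z, rfl, hxy, hxz⟩
    · intro x hx
      obtain ⟨w, hw, -, x', y, z, he, h1, -⟩ := hc x hx
      obtain ⟨rfl, rfl⟩ := pair_inj.1 he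
      exact ⟨y, mem_lv.2 ((rank_lt_rank_pair_left y z).trans (mem_lv.1 hw)), h1⟩
    · intro x hx
      obtain ⟨w, hw, -, x', y, z, he, -, h1⟩ := hc x hx
      obtain ⟨rfl, rfl⟩ := pair_inj.1 he
      exact ⟨z, mem_lv.2 ((rank_lt_rank_pair_right y z).trans (mem_lv.1 hw)), h1⟩

theorem eventually_clubFilter {γ : Ordinal.{u}} (hγ : IsSuccLimit γ) {p : Ordinal.{u} → Prop} :
    (∀ᶠ δ in clubFilter γ, p δ) ↔ ∃ F ⊆ lv γ, RelClosed F γ ∧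
      ∀ δ < γ, 0 < δ → RelClosed F δ → p δ :=
  ⟨fun h => h hγ, fun h _ => h⟩

theorem frequently_clubFilter {γ : Ordinal.{u}} (hγ : IsSuccLimit γ) {p : Ordinal.{u} → Prop} :
    (∃ᶠ δ in clubFilter γ, p δ) ↔ ∀ F ⊆ lv γ, RelClosed F γ →
      ∃ δ < γ, 0 < δ ∧ RelClosed F δ ∧ p δ := by
  rw [Filter.Frequently, eventually_clubFilter hγ]
  push Not
  rfl

theorem isSuccLimit_of_neBot {γ : Ordinal.{u}} [h : (clubFilter γ).NeBot] : IsSuccLimit γ := by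
  by_contra hγ
  exact h.ne (Filter.empty_mem_iff_bot.1 fun h => (hγ h).elim)

theorem eventually_lt_self (γ : Ordinal.{u}) : ∀ᶠ δ in clubFilter γ, δ < γ := by
  by_cases hγ : IsSuccLimit γ
  · rw [eventually_clubFilter hγ]
    exact ⟨lv γ, subset_rfl,
      fun x hx => ⟨x, hx, (pair_mem_lv hγ).2 ⟨hx, hx⟩⟩, fun _ h _ _ => h⟩
  · exact fun h => (hγ h).elim

theorem eventually_pos (γ : Ordinal.{u}) : ∀ᶠ δ in clubFilter γ, 0 < δ := by
  by_cases hγ : IsSuccLimit γ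
  · rw [eventually_clubFilter hγ]
    exact ⟨lv γ, subset_rfl,
      fun x hx => ⟨x, hx, (pair_mem_lv hγ).2 ⟨hx, hx⟩⟩, fun _ _ h _ => h⟩
  · exact fun h => (hγ h).elim

theorem eventually_closed (γ : Ordinal.{u}) {G : ZFSet.{u} → ZFSet.{u} → Prop}
    (hG : ∀ x ∈ lv γ, ∃ y ∈ lv γ, G x y) :
    ∀ᶠ δ in clubFilter γ, ∀ x ∈ lv δ, ∃ y ∈ lv δ, G x y := by
  by_cases hγ : IsSuccLimit γ
  · rw [eventually_clubFilter hγ]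
    refine ⟨{p | p ∈ lv γ ∧ ∃ x y, p = pair x y ∧ G x y}, fun p hp => hp.1,
      fun x hx => ?_, fun δ _ _ hc x hx => ?_⟩
    · obtain ⟨y, hy, h⟩ := hG x hx
      exact ⟨y, hy, (pair_mem_lv hγ).2 ⟨hx, hy⟩, x, y, rfl, h⟩
    · obtain ⟨y, hy, -, x', y', he, h⟩ := hc x hx
      obtain ⟨rfl, rfl⟩ := pair_inj.1 he
      exact ⟨y, hy, h⟩
  · exact fun h => (hγ h).elim

theorem empty_mem_lv {γ : Ordinal.{u}} (hγ : 0 < γ) : (∅ : ZFSet.{u}) ∈ lv γ := by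
  rwa [mem_lv, rank_empty]

theorem vonNeumann_mem_lv {α γ : Ordinal.{u}} : V_ α ∈ lv γ ↔ α < γ := by
  rw [mem_lv, rank_vonNeumann]

theorem eventually_gt {α γ : Ordinal.{u}} (h : α < γ) : ∀ᶠ δ in clubFilter γ, α < δ := by
  have := eventually_closed γ (G := fun _ y => y = V_ α)
    fun x _ => ⟨V_ α, vonNeumann_mem_lv.2 h, rfl⟩
  filter_upwards [this, eventually_pos γ] with δ h1 h0
  obtain ⟨y, hy, rfl⟩ := h1 ∅ (empty_mem_lv h0)
  exact vonNeumann_mem_lv.1 hy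

theorem eventually_isSuccLimit (γ : Ordinal.{u}) :
    ∀ᶠ δ in clubFilter γ, IsSuccLimit δ := by
  by_cases hγ : IsSuccLimit γ
  · have := eventually_closed γ (G := fun x y => x ∈ y) fun x hx =>
      ⟨{x}, mem_lv.2 (by rw [rank_singleton]; exact hγ.succ_lt (mem_lv.1 hx)), by simp⟩
    filter_upwards [this, eventually_pos γ] with δ h1 h0
    refine ⟨not_isMin_of_lt h0, isSuccPrelimit_of_succ_lt fun α hα => ?_⟩
    obtain ⟨y, hy, h⟩ := h1 (V_ α) (vonNeumann_mem_lv.2 hα)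
    have := rank_lt_of_mem h
    rw [rank_vonNeumann] at this
    exact (succ_le_of_lt this).trans_lt (mem_lv.1 hy)
  · exact fun h => (hγ h).elim

/-- A code for a finite tuple of sets as a single set. -/
noncomputable def tupleCode : {m : ℕ} → (Fin m → ZFSet.{u}) → ZFSet.{u}
  | 0, _ => ∅
  | _ + 1, e => pair (e 0) (tupleCode (Fin.tail e))

theorem tupleCode_injective : ∀ {m : ℕ}, Function.Injective (tupleCode.{u} (m := m))
  | 0, _, _, _ => Subsingleton.elim _ _
  | m + 1, e, e', h => by
    obtain ⟨h0, h1⟩ := pair_inj.1 h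
    rw [← Fin.cons_self_tail e, ← Fin.cons_self_tail e', h0, tupleCode_injective h1]

theorem tupleCode_mem_lv {γ : Ordinal.{u}} (hγ : IsSuccLimit γ) : ∀ {m : ℕ}
    {e : Fin m → ZFSet.{u}}, (∀ i, e i ∈ lv γ) → tupleCode e ∈ lv γ
  | 0, _, _ => empty_mem_lv (bot_lt_iff_ne_bot.2 hγ.ne_bot)
  | _ + 1, _, h => (pair_mem_lv hγ).2 ⟨h 0, tupleCode_mem_lv hγ fun i => h i.succ⟩

/-- Löwenheim–Skolem: for almost all `δ`, `V_ δ` reflects a first-order formula about `V_ γ`. -/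
theorem FOFormula.eventually_sat_iff (γ : Ordinal.{u}) {k m : ℕ}
    (s : Fin k → Set ZFSet.{u}) (φ : FOFormula k m) :
    ∀ᶠ δ in clubFilter γ, ∀ e : Fin m → ZFSet.{u}, (∀ i, e i ∈ lv δ) →
      (φ.Sat (V_ δ) (fun i => s i ∩ lv δ) e ↔ φ.Sat (V_ γ) s e) := by
  induction φ with
  | eq i j => exact .of_forall fun δ e _ => Iff.rfl
  | mem i j => exact .of_forall fun δ e _ => Iff.rfl
  | inSet i X => exact .of_forall fun δ e he => and_iff_left (he i)
  | neg φ ih => filter_upwards [ih] with δ h e he using not_congr (h e he)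
  | and φ ψ ih1 ih2 =>
    filter_upwards [ih1, ih2] with δ h1 h2 e he using and_congr (h1 e he) (h2 e he)
  | @all m φ ih =>
    -- Closure under a function picking, for each tuple, a counterexample to `φ`.
    have hw := eventually_closed γ (G := fun p y => ∀ e, p = tupleCode e →
      (∃ x ∈ V_ γ, ¬ φ.Sat (V_ γ) s (Fin.cons x e)) → ¬ φ.Sat (V_ γ) s (Fin.cons y e)) (by
      intro p hp
      by_cases h : ∃ e, p = tupleCode e ∧ ∃ x ∈ V_ γ, ¬ φ.Sat (V_ γ) s (Fin.cons x e)
      · obtain ⟨e, rfl, x, hx, hφ⟩ := h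
        refine ⟨x, hx, fun e' he' _ => ?_⟩
        rwa [← tupleCode_injective he']
      · exact ⟨p, hp, fun e he hx => (h ⟨e, he, hx⟩).elim⟩)
    filter_upwards [ih, hw, eventually_isSuccLimit γ, eventually_lt_self γ]
      with δ h1 h2 h3 h4 e he
    have key : ∀ x ∈ lv δ, (φ.Sat (V_ δ) (fun i => s i ∩ lv δ) (Fin.cons x e) ↔
        φ.Sat (V_ γ) s (Fin.cons x e)) :=
      fun x hx => h1 _ (Fin.cases hx he)
    refine ⟨fun h => ?_, fun h x hx => (key x hx).2 (h x (lv_mono h4.le hx))⟩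
    by_contra hc
    simp only [FOFormula.Sat, not_forall] at hc
    obtain ⟨x, hx, hxc⟩ := hc
    obtain ⟨y, hy, hyc⟩ := h2 _ (tupleCode_mem_lv h3 he)
    exact hyc e rfl ⟨x, hx, hxc⟩ ((key y hy).1 (h y hy))

/-! ### Semantic normal forms -/

theorem Side.dual_dual (b : Side) : b.dual.dual = b := by cases b <;> rfl

/-- The intersections of the members of `s` with `V_ δ`. -/
def restr (δ : Ordinal.{u}) (s : List (Set ZFSet.{u})) : List (Set ZFSet.{u}) :=
  s.map (· ∩ lv δ)

/-- The normal form with `n` alternating set quantifiers over `V_ γ`. In place of a first-order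
matrix there is an arbitrary condition `E` on the restrictions of the set variables to `V_ δ`; it
has to hold for almost all `δ` if the last set quantifier is existential, and for positively many
`δ` if that quantifier is universal. The list of the set variables begins with the one bound
last. -/
def Nf : Side → ℕ → (Ordinal.{u} → List (Set ZFSet.{u}) → Prop) → Ordinal.{u} →
    List (Set ZFSet.{u}) → Prop
  | .pi, 0, E, γ, s => ∀ᶠ δ in clubFilter γ, E δ (restr δ s)
  | .sigma, 0, E, γ, s => ∃ᶠ δ in clubFilter γ, E δ (restr δ s)
  | .pi, n + 1, E, γ, s => ∀ Z ⊆ lv γ, Nf .sigma n E γ (Z :: s)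
  | .sigma, n + 1, E, γ, s => ∃ Z ⊆ lv γ, Nf .pi n E γ (Z :: s)

theorem not_nf (b : Side) (n : ℕ) (E : Ordinal.{u} → List (Set ZFSet.{u}) → Prop)
    (γ : Ordinal.{u}) (s : List (Set ZFSet.{u})) :
    ¬ Nf b n E γ s ↔ Nf b.dual n (fun δ l => ¬ E δ l) γ s := by
  induction n generalizing b s with
  | zero => cases b <;> simp [Nf, Side.dual]
  | succ n ih =>
    cases b
    · simp only [Nf, Side.dual, not_forall, exists_prop]
      exact exists_congr fun Z => and_congr_right fun _ => ih .sigma _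
    · simp only [Nf, Side.dual, not_exists, not_and]
      exact forall_congr' fun Z => imp_congr_right fun _ => ih .pi _

/-- Normal forms agree when their matrices agree at almost all `δ`, whatever the restrictions `l`
of the quantified set variables are. -/
theorem nf_congr {b : Side} {n : ℕ} {E E' : Ordinal.{u} → List (Set ZFSet.{u}) → Prop}
    {γ : Ordinal.{u}} {s t : List (Set ZFSet.{u})}
    (h : ∀ᶠ δ in clubFilter γ, ∀ l : List (Set ZFSet.{u}), l.length = n →
      (E δ (l ++ restr δ s) ↔ E' δ (l ++ restr δ t))) :
    Nf b n E γ s ↔ Nf b n E' γ t := by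
  induction n generalizing b s t with
  | zero =>
    cases b
    · exact eventually_congr (h.mono fun δ hδ => hδ [] rfl)
    · exact frequently_congr (h.mono fun δ hδ => hδ [] rfl)
  | succ n ih =>
    have key : ∀ b : Side, ∀ Z : Set ZFSet.{u}, Nf b n E γ (Z :: s) ↔ Nf b n E' γ (Z :: t) := by
      intro b Z
      refine ih (h.mono fun δ hδ l hl => ?_)
      have := hδ (l ++ [Z ∩ lv δ]) (by simp [hl])
      rwa [List.append_assoc, List.append_assoc] at this
    cases b
    · exact forall_congr' fun Z => imp_congr_right fun _ => key _ Z
    · exact exists_congr fun Z => and_congr_right fun _ => key _ Z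

theorem nf_const {b : Side} {n : ℕ} {γ : Ordinal.{u}} [(clubFilter γ).NeBot]
    {s : List (Set ZFSet.{u})} (c : Prop) : Nf b n (fun _ _ => c) γ s ↔ c := by
  induction n generalizing b s with
  | zero => cases b <;> simp [Nf]
  | succ n ih =>
    cases b
    · simp only [Nf, ih]
      exact ⟨fun h => h ∅ (Set.empty_subset _), fun h _ _ => h⟩
    · simp only [Nf, ih]
      exact ⟨fun ⟨_, _, h⟩ => h, fun h => ⟨∅, Set.empty_subset _, h⟩⟩

/-- Substitution of `g` for the free set variables of a matrix below `n` set quantifiers. -/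
def substAt (n : ℕ) (g : Ordinal.{u} → List (Set ZFSet.{u}) → List (Set ZFSet.{u}))
    (E : Ordinal.{u} → List (Set ZFSet.{u}) → Prop) :
    Ordinal.{u} → List (Set ZFSet.{u}) → Prop :=
  fun δ l => E δ (l.take n ++ g δ (l.drop n))

theorem nf_substAt {b : Side} {n : ℕ}
    {g : Ordinal.{u} → List (Set ZFSet.{u}) → List (Set ZFSet.{u})}
    {E : Ordinal.{u} → List (Set ZFSet.{u}) → Prop} {γ : Ordinal.{u}}
    {s t : List (Set ZFSet.{u})}
    (h : ∀ᶠ δ in clubFilter γ, g δ (restr δ t) = restr δ s) :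
    Nf b n (substAt n g E) γ t ↔ Nf b n E γ s := by
  refine nf_congr (h.mono fun δ hδ l hl => ?_)
  rw [substAt, ← hδ, List.take_left' hl, List.drop_left' hl]

/-- The property of a predicate that, at every `γ` whose closure filter is proper, it is given by
a normal form on side `b` with `n` set quantifiers. Such a predicate may involve arbitrary
parameters, as the matrix of a normal form is an arbitrary condition. -/
def SemDef (b : Side) (n : ℕ) (P : Ordinal.{u} → List (Set ZFSet.{u}) → Prop) : Prop :=
  ∃ E, ∀ γ, (clubFilter γ).NeBot → ∀ s : List (Set ZFSet.{u}), (∀ X ∈ s, X ⊆ lv γ) →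
    (P γ s ↔ Nf b n E γ s)

theorem SemDef.not {b : Side} {n : ℕ} {P : Ordinal.{u} → List (Set ZFSet.{u}) → Prop}
    (h : SemDef b n P) : SemDef b.dual n (fun γ s => ¬ P γ s) := by
  obtain ⟨E, hE⟩ := h
  exact ⟨_, fun γ hγ s hs => (not_congr (hE γ hγ s hs)).trans (not_nf b n E γ s)⟩

theorem SemDef.of_not {b : Side} {n : ℕ} {P : Ordinal.{u} → List (Set ZFSet.{u}) → Prop}
    (h : SemDef b.dual n (fun γ s => ¬ P γ s)) : SemDef b n P := by
  simpa [Side.dual_dual] using h.not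

theorem SemDef.const {b : Side} {n : ℕ} (c : Prop) : SemDef.{u} b n (fun _ _ => c) :=
  ⟨fun _ _ => c, fun _ _ _ _ => (nf_const c).symm⟩

/-- A dummy quantifier raises the level of a predicate. -/
theorem SemDef.dual {b : Side} {n : ℕ} {P : Ordinal.{u} → List (Set ZFSet.{u}) → Prop}
    (h : SemDef b.dual n P) : SemDef b (n + 1) P := by
  obtain ⟨E, hE⟩ := h
  refine ⟨substAt n (fun _ => List.tail) E, fun γ hγ s hs => ?_⟩
  have key : ∀ b' Z, Nf b' n (substAt n (fun _ => List.tail) E) γ (Z :: s) ↔ Nf b' n E γ s :=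
    fun b' Z => nf_substAt (.of_forall fun δ => rfl)
  cases b
  · simp only [Nf, key]
    exact (hE γ hγ s hs).trans ⟨fun h _ _ => h, fun h => h ∅ (Set.empty_subset _)⟩
  · simp only [Nf, key]
    exact (hE γ hγ s hs).trans ⟨fun h => ⟨∅, Set.empty_subset _, h⟩, fun ⟨_, _, h⟩ => h⟩

theorem SemDef.forall_of_sigma {n : ℕ} {P : Ordinal.{u} → List (Set ZFSet.{u}) → Prop}
    (h : SemDef .sigma n P) : SemDef .pi (n + 1) (fun γ s => ∀ X ⊆ lv γ, P γ (X :: s)) := by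
  obtain ⟨E, hE⟩ := h
  refine ⟨E, fun γ hγ s hs => forall_congr' fun X => imp_congr_right fun hX => ?_⟩
  exact hE γ hγ _ (List.forall_mem_cons.2 ⟨hX, hs⟩)

/-- The set of all `x` such that the pair of `a` and `x` belongs to `Z`. -/
def fiber (a : ZFSet.{u}) (Z : Set ZFSet.{u}) : Set ZFSet.{u} := {x | pair a x ∈ Z}

theorem fiber_inter_lv {a : ZFSet.{u}} {δ : Ordinal.{u}} (hδ : IsSuccLimit δ)
    (ha : a ∈ lv δ) (Z : Set ZFSet.{u}) : fiber a Z ∩ lv δ = fiber a (Z ∩ lv δ) := by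
  ext x
  simp [fiber, pair_mem_lv hδ, ha]

theorem empty_ne_singleton_empty : (∅ : ZFSet.{u}) ≠ {∅} := fun h => by
  simpa using congrArg rank h

/-- Two successive universal set quantifiers are contracted into one. -/
theorem SemDef.forall {n : ℕ} {P : Ordinal.{u} → List (Set ZFSet.{u}) → Prop}
    (h : SemDef .pi (n + 1) P) : SemDef .pi (n + 1) (fun γ s => ∀ X ⊆ lv γ, P γ (X :: s)) := by
  obtain ⟨E, hE⟩ := h
  let g : List (Set ZFSet.{u}) → List (Set ZFSet.{u})
    | [] => []
    | Z :: s => fiber ∅ Z :: fiber {∅} Z :: s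
  refine ⟨substAt n (fun _ => g) E, fun γ hγ s hs => ?_⟩
  have hlim : IsSuccLimit γ := isSuccLimit_of_neBot
  have h0 : ∀ δ : Ordinal.{u}, IsSuccLimit δ → (∅ : ZFSet.{u}) ∈ lv δ :=
    fun δ hδ => empty_mem_lv (bot_lt_iff_ne_bot.2 hδ.ne_bot)
  have h1 : ∀ δ : Ordinal.{u}, IsSuccLimit δ → ({∅} : ZFSet.{u}) ∈ lv δ := fun δ hδ => by
    rw [mem_lv, rank_singleton]
    exact hδ.succ_lt (mem_lv.1 (h0 δ hδ))
  have hsec : ∀ a, ∀ Z ⊆ lv γ, fiber a Z ⊆ lv γ :=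
    fun a Z hZ x hx => ((pair_mem_lv hlim).1 (hZ hx)).2
  have key : ∀ Z, Nf .sigma n (substAt n (fun _ => g) E) γ (Z :: s) ↔
      Nf .sigma n E γ (fiber ∅ Z :: fiber {∅} Z :: s) := fun Z => by
    refine nf_substAt ((eventually_isSuccLimit γ).mono fun δ hδ => ?_)
    change fiber ∅ (Z ∩ lv δ) :: fiber {∅} (Z ∩ lv δ) :: restr δ s = _
    rw [← fiber_inter_lv hδ (h0 δ hδ), ← fiber_inter_lv hδ (h1 δ hδ)]
    rfl
  simp only [Nf, key]
  constructor
  · intro H Z hZ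
    have := H _ (hsec {∅} Z hZ)
    rw [hE γ hγ _ (List.forall_mem_cons.2 ⟨hsec _ Z hZ, hs⟩)] at this
    exact this _ (hsec ∅ Z hZ)
  · intro H X hX
    rw [hE γ hγ _ (List.forall_mem_cons.2 ⟨hX, hs⟩)]
    intro Y hY
    have := H (pair ∅ '' Y ∪ pair {∅} '' X) (by
      rintro _ (⟨y, hy, rfl⟩ | ⟨x, hx, rfl⟩)
      · exact (pair_mem_lv hlim).2 ⟨h0 γ hlim, hY hy⟩
      · exact (pair_mem_lv hlim).2 ⟨h1 γ hlim, hX hx⟩)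
    have e1 : fiber ∅ (pair ∅ '' Y ∪ pair {∅} '' X) = Y := by
      ext x
      simp [fiber, pair_inj, empty_ne_singleton_empty.symm]
    have e2 : fiber {∅} (pair ∅ '' Y ∪ pair {∅} '' X) = X := by
      ext x
      simp [fiber, pair_inj, empty_ne_singleton_empty]
    rwa [e1, e2] at this

theorem SemDef.exists {n : ℕ} {P : Ordinal.{u} → List (Set ZFSet.{u}) → Prop}
    (h : SemDef .sigma (n + 1) P) :
    SemDef .sigma (n + 1) (fun γ s => ∃ X ⊆ lv γ, P γ (X :: s)) := by
  refine SemDef.of_not ?_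
  simpa [Side.dual] using SemDef.forall (h.not : SemDef .pi (n + 1) _)

/-- The interpretation of `k` free set variables by the members of a list. -/
def env (k : ℕ) (s : List (Set ZFSet.{u})) : Fin k → Set ZFSet.{u} := fun i => s.getD i ∅

theorem cons_env (k : ℕ) (X : Set ZFSet.{u}) (s : List (Set ZFSet.{u})) :
    (Fin.cons X (env k s) : Fin (k + 1) → Set ZFSet.{u}) = env (k + 1) (X :: s) := by
  funext i
  refine Fin.cases rfl (fun i => ?_) i
  simp [env]

theorem env_restr (k : ℕ) (δ : Ordinal.{u}) (s : List (Set ZFSet.{u})) :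
    env k (restr δ s) = fun i => env k s i ∩ lv δ := by
  funext i
  simp only [env, restr, List.getD_eq_getElem?_getD, List.getElem?_map]
  cases s[(i : ℕ)]? <;> simp

/-- Every second-order formula is equivalent to a normal form of its level. -/
theorem HasLevel.semDef {b : Side} {n k : ℕ} {φ : SOFormula k} (h : HasLevel b n φ) :
    SemDef.{u} b n (fun γ s => φ.Sat (V_ γ) (env k s)) := by
  induction h with
  | @matrix b k φ =>
    refine ⟨fun δ l => φ.Sat (V_ δ) (env k l) Fin.elim0, fun γ hγ s _ => ?_⟩
    have := φ.eventually_sat_iff γ (env k s)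
    have key : ∀ᶠ δ in clubFilter γ, φ.Sat (V_ δ) (env k (restr δ s)) Fin.elim0 ↔
        φ.Sat (V_ γ) (env k s) Fin.elim0 := by
      filter_upwards [this] with δ hδ
      rw [env_restr]
      exact hδ Fin.elim0 fun i => i.elim0
    cases b
    · simp [Nf, SOFormula.Sat, eventually_congr key]
    · simp [Nf, SOFormula.Sat, frequently_congr key]
  | dual h ih => exact ih.dual
  | all h ih =>
    simp only [SOFormula.Sat, cons_env]
    exact ih.forall
  | ex h ih =>
    simp only [SOFormula.Sat, cons_env]
    exact ih.exists

/-! ### First-order definability -/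

/-- `P` is defined over every structure by a single first-order formula. -/
def FODef {k m : ℕ}
    (P : ZFSet.{u} → (Fin k → Set ZFSet.{u}) → (Fin m → ZFSet.{u}) → Prop) : Prop :=
  ∃ φ : FOFormula k m, ∀ M s e, φ.Sat M s e ↔ P M s e

namespace FODef

variable {k m : ℕ} {P Q : ZFSet.{u} → (Fin k → Set ZFSet.{u}) → (Fin m → ZFSet.{u}) → Prop}

theorem eq (i j : Fin m) : FODef.{u} (k := k) (fun _ _ e => e i = e j) :=
  ⟨.eq i j, fun _ _ _ => Iff.rfl⟩

theorem mem (i j : Fin m) : FODef.{u} (k := k) (fun _ _ e => e i ∈ e j) :=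
  ⟨.mem i j, fun _ _ _ => Iff.rfl⟩

theorem inSet (i : Fin m) (X : Fin k) : FODef.{u} (fun _ s e => e i ∈ s X) :=
  ⟨.inSet i X, fun _ _ _ => Iff.rfl⟩

theorem not (h : FODef P) : FODef (fun M s e => ¬ P M s e) := by
  obtain ⟨φ, h⟩ := h
  exact ⟨.neg φ, fun M s e => not_congr (h M s e)⟩

theorem and (h : FODef P) (h' : FODef Q) : FODef (fun M s e => P M s e ∧ Q M s e) := by
  obtain ⟨φ, h⟩ := h
  obtain ⟨ψ, h'⟩ := h'
  exact ⟨.and φ ψ, fun M s e => and_congr (h M s e) (h' M s e)⟩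

theorem imp (h : FODef P) (h' : FODef Q) : FODef (fun M s e => P M s e → Q M s e) := by
  simpa only [not_and, not_not] using (h.and h'.not).not

theorem or (h : FODef P) (h' : FODef Q) : FODef (fun M s e => P M s e ∨ Q M s e) := by
  simpa only [← or_iff_not_imp_left] using h.not.imp h'

theorem iff (h : FODef P) (h' : FODef Q) : FODef (fun M s e => P M s e ↔ Q M s e) := by
  simpa only [← iff_def] using (h.imp h').and (h'.imp h)

variable {R : ZFSet.{u} → (Fin k → Set ZFSet.{u}) → ZFSet.{u} → (Fin m → ZFSet.{u}) → Prop}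

theorem all (h : FODef fun M s (e : Fin (m + 1) → ZFSet.{u}) => R M s (e 0) (Fin.tail e)) :
    FODef (fun M s e => ∀ x ∈ M, R M s x e) := by
  obtain ⟨φ, h⟩ := h
  exact ⟨.all φ, fun M s e => forall₂_congr fun x _ => h M s (Fin.cons x e)⟩

theorem ex (h : FODef fun M s (e : Fin (m + 1) → ZFSet.{u}) => R M s (e 0) (Fin.tail e)) :
    FODef (fun M s e => ∃ x ∈ M, R M s x e) := by
  simpa only [not_forall, not_not, exists_prop] using
    (FODef.all (R := fun M s x e => ¬ R M s x e) h.not).not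

end FODef

/-- The relation `p = (a, b)`, as a first-order condition over `M`. -/
def IsPair (M p a b : ZFSet.{u}) : Prop :=
  ∃ v ∈ M, ∃ w ∈ M, (∀ x ∈ M, x ∈ v ↔ x = a) ∧ (∀ x ∈ M, x ∈ w ↔ x = a ∨ x = b) ∧
    ∀ x ∈ M, x ∈ p ↔ x = v ∨ x = w

theorem FODef.isPair {k m : ℕ} (i j l : Fin m) :
    FODef.{u} (k := k) (fun M _ e => IsPair M (e i) (e j) (e l)) :=
  .ex (.ex (.and (.all (.iff (.mem _ _) (.eq _ _)))
    (.and (.all (.iff (.mem _ _) (.or (.eq _ _) (.eq _ _))))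
      (.all (.iff (.mem _ _) (.or (.eq _ _) (.eq _ _)))))))

theorem mem_trans_vonNeumann {γ : Ordinal.{u}} {x y : ZFSet.{u}} (h : x ∈ y) (hy : y ∈ V_ γ) :
    x ∈ V_ γ :=
  (isTransitive_vonNeumann γ).mem_trans h hy

theorem IsPair.eq_pair {γ : Ordinal.{u}} {p a b : ZFSet.{u}} (hp : p ∈ V_ γ) (ha : a ∈ V_ γ)
    (hb : b ∈ V_ γ) (h : IsPair (V_ γ) p a b) : p = pair a b := by
  obtain ⟨v, hv, w, hw, h1, h2, h3⟩ := h
  have ev : v = {a} := by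
    ext x
    rw [mem_singleton]
    exact ⟨fun hx => (h1 x (mem_trans_vonNeumann hx hv)).1 hx,
      fun hx => (h1 x (hx ▸ ha)).2 hx⟩
  have ew : w = {a, b} := by
    ext x
    rw [mem_pair]
    exact ⟨fun hx => (h2 x (mem_trans_vonNeumann hx hw)).1 hx,
      fun hx => (h2 x (hx.elim (· ▸ ha) (· ▸ hb))).2 hx⟩
  subst ev ew
  ext x
  rw [pair, mem_pair]
  exact ⟨fun hx => (h3 x (mem_trans_vonNeumann hx hp)).1 hx,
    fun hx => (h3 x (hx.elim (· ▸ hv) (· ▸ hw))).2 hx⟩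

theorem isPair_iff {γ : Ordinal.{u}} {p a b : ZFSet.{u}} (hp : p ∈ V_ γ)
    (ha : a ∈ V_ γ) (hb : b ∈ V_ γ) : IsPair (V_ γ) p a b ↔ p = pair a b := by
  refine ⟨IsPair.eq_pair hp ha hb, ?_⟩
  rintro rfl
  exact ⟨{a}, mem_trans_vonNeumann (by simp [pair]) hp, {a, b},
    mem_trans_vonNeumann (by simp [pair]) hp, by simp, by simp, by simp [pair]⟩

/-- The condition that the relation `F` is total, as a first-order condition over `M`. -/
def IsTotal (M : ZFSet.{u}) (F : Set ZFSet.{u}) : Prop :=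
  ∀ x ∈ M, ∃ y ∈ M, ∃ p ∈ M, IsPair M p x y ∧ p ∈ F

theorem FODef.isTotal {k m : ℕ} (X : Fin k) :
    FODef.{u} (m := m) (fun M s _ => IsTotal M (s X)) :=
  .all (.ex (.ex (.and (.isPair _ _ _) (.inSet _ _))))

theorem IsTotal.isClosed {γ : Ordinal.{u}} {F : Set ZFSet.{u}} (h : IsTotal (V_ γ) F) :
    RelClosed F γ := by
  intro x hx
  obtain ⟨y, hy, p, hp, h1, h2⟩ := h x hx
  exact ⟨y, hy, h1.eq_pair hp hx hy ▸ h2⟩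

theorem isTotal_iff {γ : Ordinal.{u}} (hγ : IsSuccLimit γ) {F : Set ZFSet.{u}} :
    IsTotal (V_ γ) F ↔ RelClosed F γ := by
  refine ⟨IsTotal.isClosed, fun h x hx => ?_⟩
  obtain ⟨y, hy, h1⟩ := h x hx
  have hp := (pair_mem_lv hγ).2 ⟨hx, hy⟩
  exact ⟨y, hy, _, hp, (isPair_iff hp hx hy).2 rfl, h1⟩

/-- The condition that `d` is nonempty and closed under the relation `F`, as a first-order
condition over `M`. -/
def IsClosedIn (M : ZFSet.{u}) (F : Set ZFSet.{u}) (d : ZFSet.{u}) : Prop :=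
  (∃ x ∈ M, x ∈ d) ∧ ∀ x ∈ M, x ∈ d → ∃ y ∈ M, y ∈ d ∧ ∃ p ∈ M, IsPair M p x y ∧ p ∈ F

theorem FODef.isClosedIn {k m : ℕ} (X : Fin k) (i : Fin m) :
    FODef.{u} (fun M s e => IsClosedIn M (s X) (e i)) :=
  .and (.ex (.mem _ _)) (.all (.imp (.mem _ _) (.ex (.and (.mem _ _)
    (.ex (.and (.isPair _ _ _) (.inSet _ _)))))))

theorem isClosedIn_iff {γ δ : Ordinal.{u}} (hγ : IsSuccLimit γ) (hδ : δ < γ)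
    {F : Set ZFSet.{u}} : IsClosedIn (V_ γ) F (V_ δ) ↔ 0 < δ ∧ RelClosed F δ := by
  have hsub : ∀ x, x ∈ V_ δ → x ∈ V_ γ := fun x hx => lv_mono hδ.le hx
  refine and_congr ⟨?_, fun h => ⟨∅, hsub _ (empty_mem_lv h), empty_mem_lv h⟩⟩
    ⟨fun h x hx => ?_, fun h x hx hxd => ?_⟩
  · rintro ⟨x, -, hx⟩
    exact (mem_lv.1 hx).bot_lt
  · obtain ⟨y, hy, hyd, p, hp, h1, h2⟩ := h x (hsub x hx) hx
    exact ⟨y, hyd, h1.eq_pair hp (hsub x hx) hy ▸ h2⟩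
  · obtain ⟨y, hy, h1⟩ := h x hxd
    have hp := (pair_mem_lv hγ).2 ⟨hx, hsub y hy⟩
    exact ⟨y, hsub y hy, hy, _, hp, (isPair_iff hp hx (hsub y hy)).2 rfl, h1⟩

/-- A code for `d` together with the intersections of `d` with the members of a list. -/
noncomputable def traceCode (d : ZFSet.{u}) : List (Set ZFSet.{u}) → ZFSet.{u}
  | [] => d
  | Z :: l => pair (d.sep (· ∈ Z)) (traceCode d l)

theorem traceCode_mem_lv {γ : Ordinal.{u}} (hγ : IsSuccLimit γ) {d : ZFSet.{u}}
    (hd : d ∈ lv γ) : ∀ l, traceCode d l ∈ lv γ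
  | [] => hd
  | _ :: l => (pair_mem_lv hγ).2
    ⟨mem_vonNeumann_of_subset (fun _ hx => (mem_sep.1 hx).1) hd, traceCode_mem_lv hγ hd l⟩

theorem traceCode_eq {δ : Ordinal.{u}} {d : ZFSet.{u}} : ∀ {l l' : List (Set ZFSet.{u})},
    l.length = l'.length → traceCode (V_ δ) l = traceCode d l' →
      d = V_ δ ∧ restr δ l = restr δ l'
  | [], [], _, h => ⟨h.symm, rfl⟩
  | Z :: l, Z' :: l', hl, h => by
    obtain ⟨h1, h2⟩ := pair_inj.1 h
    obtain ⟨rfl, h3⟩ := traceCode_eq (Nat.succ.inj hl) h2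
    refine ⟨rfl, congrArg₂ List.cons ?_ h3⟩
    ext x
    have h := ZFSet.ext_iff.1 h1 x
    rw [mem_sep, mem_sep] at h
    exact and_comm.trans (h.trans and_comm)

/-- The relation between `p` and `d` that `p` codes `d` together with the intersections of `d`
with the listed set variables, as a first-order condition over `M`. -/
def IsTrace {k : ℕ} (M : ZFSet.{u}) (s : Fin k → Set ZFSet.{u}) (p d : ZFSet.{u}) :
    List (Fin k) → Prop
  | [] => p = d
  | i :: is => ∃ z ∈ M, ∃ q ∈ M, IsPair M p z q ∧ (∀ x ∈ M, x ∈ z ↔ x ∈ d ∧ x ∈ s i) ∧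
      IsTrace M s q d is

theorem FODef.isTrace {k m : ℕ} (i j : Fin m) (is : List (Fin k)) :
    FODef.{u} (fun M s e => IsTrace M s (e i) (e j) is) := by
  induction is generalizing m with
  | nil => exact .eq i j
  | cons a is ih =>
    exact .ex (.ex (.and (.isPair _ _ _) (.and
      (.all (.iff (.mem _ _) (.and (.mem _ _) (.inSet _ _)))) (ih 0 j.succ.succ))))

theorem isTrace_iff {γ : Ordinal.{u}} (hγ : IsSuccLimit γ) {k : ℕ}
    {s : Fin k → Set ZFSet.{u}} {p d : ZFSet.{u}} (hp : p ∈ V_ γ) (hd : d ∈ V_ γ)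
    (is : List (Fin k)) : IsTrace (V_ γ) s p d is ↔ p = traceCode d (is.map s) := by
  induction is generalizing p with
  | nil => rfl
  | cons i is ih =>
    have hsep : d.sep (· ∈ s i) ∈ V_ γ :=
      mem_vonNeumann_of_subset (fun _ hx => (mem_sep.1 hx).1) hd
    constructor
    · rintro ⟨z, hz, q, hq, h1, h2, h3⟩
      rw [h1.eq_pair hp hz hq, (ih hq).1 h3, List.map_cons, traceCode]
      congr 1
      ext x
      rw [mem_sep]
      refine ⟨fun hx => (h2 x (mem_trans_vonNeumann hx hz)).1 hx,
        fun hx => (h2 x (mem_trans_vonNeumann hx.1 hd)).2 hx⟩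
    · rintro rfl
      have hq : traceCode d (is.map s) ∈ V_ γ := traceCode_mem_lv hγ hd _
      exact ⟨_, hsep, _, hq, (isPair_iff hp hsep hq).2 rfl, by simp, (ih hq).2 rfl⟩

/-! ### Formulas for normal forms -/

/-- The set coding the matrix `E` for lists of length `N`, along with the class of all `V_ δ`. The
two parts are told apart by a tag, which is empty for the first and nonempty for the second. -/
def codeSet (N : ℕ) (E : Ordinal.{u} → List (Set ZFSet.{u}) → Prop) : Set ZFSet.{u} :=
  {q | ∃ δ l, l.length = N ∧ E δ (restr δ l) ∧ q = pair ∅ (traceCode (V_ δ) l)} ∪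
    {q | ∃ δ, q = pair {∅} (V_ δ)}

theorem pair_traceCode_mem_codeSet {N : ℕ} {E : Ordinal.{u} → List (Set ZFSet.{u}) → Prop}
    {d : ZFSet.{u}} {l : List (Set ZFSet.{u})} (hl : l.length = N) :
    pair ∅ (traceCode d l) ∈ codeSet N E ↔ ∃ δ, d = V_ δ ∧ E δ (restr δ l) := by
  constructor
  · rintro (⟨δ, l', hl', hE, h⟩ | ⟨δ, h⟩)
    · obtain ⟨rfl, h'⟩ := traceCode_eq (hl'.trans hl.symm) (pair_inj.1 h).2.symm
      exact ⟨δ, rfl, h' ▸ hE⟩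
    · exact (empty_ne_singleton_empty (pair_inj.1 h).1).elim
  · rintro ⟨δ, rfl, hE⟩
    exact .inl ⟨δ, l, hl, hE, rfl⟩

theorem pair_mem_codeSet {N : ℕ} {E : Ordinal.{u} → List (Set ZFSet.{u}) → Prop}
    {t d : ZFSet.{u}} (ht : t ≠ ∅) (h : pair t d ∈ codeSet N E) : ∃ δ, d = V_ δ := by
  obtain (⟨δ, l', -, -, h⟩ | ⟨δ, h⟩) := h
  · exact (ht (pair_inj.1 h).1).elim
  · exact ⟨δ, (pair_inj.1 h).2⟩

/-- The first-order matrix for normal forms with list of set variables `is`. -/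
def NfMatrix {k : ℕ} (M : ZFSet.{u}) (s : Fin k → Set ZFSet.{u}) (F A : Fin k)
    (is : List (Fin k)) : Prop :=
  IsTotal M (s F) → ∃ d ∈ M, IsClosedIn M (s F) d ∧ ∃ p ∈ M, IsTrace M s p d is ∧
    ∃ t ∈ M, (∀ x ∈ M, ¬ x ∈ t) ∧ ∃ q ∈ M, IsPair M q t p ∧ q ∈ s A

theorem FODef.nfMatrix {k m : ℕ} (F A : Fin k) (is : List (Fin k)) :
    FODef.{u} (m := m) (fun M s _ => NfMatrix M s F A is) :=
  .imp (.isTotal _) (.ex (.and (.isClosedIn _ _) (.ex (.and (.isTrace _ _ _)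
    (.ex (.and (.all (.not (.mem _ _))) (.ex (.and (.isPair _ _ _) (.inSet _ _)))))))))

theorem nfMatrix_iff {γ : Ordinal.{u}} (hγ : IsSuccLimit γ) {N : ℕ}
    {E : Ordinal.{u} → List (Set ZFSet.{u}) → Prop} {k : ℕ} {s : Fin k → Set ZFSet.{u}}
    {F A : Fin k} {is : List (Fin k)} (hA : s A = codeSet N E ∩ lv γ) (his : is.length = N) :
    NfMatrix (V_ γ) s F A is ↔ (RelClosed (s F) γ →
      ∃ δ < γ, 0 < δ ∧ RelClosed (s F) δ ∧ E δ (restr δ (is.map s))) := by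
  have hl : (is.map s).length = N := by rw [List.length_map, his]
  refine imp_congr (isTotal_iff hγ) ⟨?_, ?_⟩
  · rintro ⟨d, hd, h1, p, hp, h2, t, ht, h3, q, hq, h4, h5⟩
    have et : t = ∅ := (eq_empty t).2 fun x hx => h3 x (mem_trans_vonNeumann hx ht) hx
    rw [hA, h4.eq_pair hq ht hp, et, (isTrace_iff hγ hp hd is).1 h2] at h5
    obtain ⟨δ, rfl, hE⟩ := (pair_traceCode_mem_codeSet hl).1 h5.1
    have hδ := vonNeumann_mem_lv.1 hd
    rw [isClosedIn_iff hγ hδ] at h1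
    exact ⟨δ, hδ, h1.1, h1.2, hE⟩
  · rintro ⟨δ, hδ, h0, hc, hE⟩
    have hd : V_ δ ∈ V_ γ := vonNeumann_mem_lv.2 hδ
    have hp : traceCode (V_ δ) (is.map s) ∈ V_ γ := traceCode_mem_lv hγ hd _
    have ht : (∅ : ZFSet.{u}) ∈ V_ γ := empty_mem_lv (h0.trans hδ)
    have hq := (pair_mem_lv hγ).2 ⟨ht, hp⟩
    refine ⟨_, hd, (isClosedIn_iff hγ hδ).2 ⟨h0, hc⟩, _, hp, (isTrace_iff hγ hp hd is).2 rfl, ∅,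
      ht, fun x _ => notMem_empty x, _, hq, (isPair_iff hq ht hp).2 rfl, ?_⟩
    rw [hA]
    exact ⟨(pair_traceCode_mem_codeSet hl).2 ⟨δ, rfl, hE⟩, hq⟩

theorem env_append_last {k : ℕ} (A : Set ZFSet.{u}) {s : List (Set ZFSet.{u})}
    (hs : s.length = k) : env (k + 1) (s ++ [A]) (Fin.last k) = A := by
  subst hs
  simp [env]

theorem map_env_append {k : ℕ} (A : Set ZFSet.{u}) {s : List (Set ZFSet.{u})}
    (hs : s.length = k) :
    (List.finRange k).map (fun i => env (k + 1) (s ++ [A]) i.castSucc) = s := by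
  subst hs
  exact List.ext_getElem (by simp) fun i _ _ => by simp [env]

/-- Normal forms on side `b` with `n` set quantifiers are expressed by one formula of level `n` on
the same side, whose predicate symbol is interpreted by the code of the matrix or of its negation.
For `n = 0`, the quantifier over the relation generating the filter makes it a formula of level `1`
on the other side. -/
theorem exists_formula_nf (b : Side) (n k : ℕ) : ∃ φ : SOFormula (k + 1),
    (n = 0 → HasLevel b.dual 1 φ) ∧ (n ≠ 0 → HasLevel b n φ) ∧
    ∀ E, ∃ E', ∀ γ, IsSuccLimit γ → ∀ s : List (Set ZFSet.{u}), s.length = k →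
      (φ.Sat (V_ γ) (env (k + 1) (s ++ [codeSet (n + k) E' ∩ lv γ])) ↔ Nf b n E γ s) := by
  induction n generalizing b k with
  | zero =>
    let is : List (Fin (k + 2)) := (List.finRange k).map fun i => i.castSucc.succ
    obtain ⟨χ, hχ⟩ := FODef.nfMatrix.{u} (m := 0) (0 : Fin (k + 2)) (Fin.last (k + 1)) is
    -- The matrix in terms of the filter base, for a single generating relation `F`.
    have key : ∀ (E : Ordinal.{u} → List (Set ZFSet.{u}) → Prop) (γ : Ordinal.{u}),
        IsSuccLimit γ → ∀ s : List (Set ZFSet.{u}), s.length = k → ∀ F : Set ZFSet.{u},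
        (χ.Sat (V_ γ) (Fin.cons F (env (k + 1) (s ++ [codeSet k E ∩ lv γ]))) Fin.elim0 ↔
          (RelClosed F γ → ∃ δ < γ, 0 < δ ∧ RelClosed F δ ∧ E δ (restr δ s))) := by
      intro E γ hγ s hs F
      refine (hχ _ _ _).trans ?_
      dsimp only
      rw [nfMatrix_iff hγ (N := k) (E := E) ?_ (by simp [is])]
      · have : is.map (Fin.cons F (env (k + 1) (s ++ [codeSet k E ∩ lv γ])) :
            Fin (k + 2) → Set ZFSet.{u}) = s := by
          rw [List.map_map]
          exact map_env_append _ hs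
        rw [this]
        rfl
      · exact env_append_last _ hs
    cases b
    · refine ⟨.ex (.matrix (.neg χ)), fun _ => .ex (.dual (.matrix _)), fun h => (h rfl).elim,
        fun E => ⟨fun δ l => ¬ E δ l, fun γ hγ s hs => ?_⟩⟩
      rw [Nf, eventually_clubFilter hγ, Nat.zero_add]
      refine exists_congr fun F => and_congr_right fun _ => (not_congr (key _ γ hγ s hs F)).trans ?_
      push Not
      rfl
    · refine ⟨.all (.matrix χ), fun _ => .all (.dual (.matrix _)), fun h => (h rfl).elim,
        fun E => ⟨E, fun γ hγ s hs => ?_⟩⟩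
      rw [Nf, frequently_clubFilter hγ, Nat.zero_add]
      exact forall₂_congr fun F _ => key E γ hγ s hs F
  | succ n ih =>
    cases b
    · obtain ⟨φ, h0, h1, h2⟩ := ih .sigma (k + 1)
      refine ⟨.all φ, fun h => by omega, fun _ => ?_, fun E => ?_⟩
      · rcases n with _ | n
        · exact .all (h0 rfl)
        · exact .all (.dual (h1 (Nat.succ_ne_zero n)))
      · obtain ⟨E', hE⟩ := h2 E
        refine ⟨E', fun γ hγ s hs => ?_⟩
        rw [Nat.add_right_comm]
        refine forall₂_congr fun Z _ => ?_
        rw [cons_env]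
        exact hE γ hγ (Z :: s) (by simp [hs])
    · obtain ⟨φ, h0, h1, h2⟩ := ih .pi (k + 1)
      refine ⟨.ex φ, fun h => by omega, fun _ => ?_, fun E => ?_⟩
      · rcases n with _ | n
        · exact .ex (h0 rfl)
        · exact .ex (.dual (h1 (Nat.succ_ne_zero n)))
      · obtain ⟨E', hE⟩ := h2 E
        refine ⟨E', fun γ hγ s hs => ?_⟩
        rw [Nat.add_right_comm]
        refine exists_congr fun Z => and_congr_right fun _ => ?_
        rw [cons_env]
        exact hE γ hγ (Z :: s) (by simp [hs])

theorem FOFormula.exists_rename {k k' m : ℕ} (φ : FOFormula k m) (f : Fin k → Fin k') :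
    ∃ φ' : FOFormula k' m, ∀ (M : ZFSet.{u}) s e, φ'.Sat M s e ↔ φ.Sat M (s ∘ f) e := by
  induction φ with
  | eq i j => exact ⟨.eq i j, fun _ _ _ => Iff.rfl⟩
  | mem i j => exact ⟨.mem i j, fun _ _ _ => Iff.rfl⟩
  | inSet i X => exact ⟨.inSet i (f X), fun _ _ _ => Iff.rfl⟩
  | neg φ ih =>
    obtain ⟨φ', h⟩ := ih
    exact ⟨.neg φ', fun M s e => not_congr (h M s e)⟩
  | and φ ψ ih ih' =>
    obtain ⟨φ', h⟩ := ih
    obtain ⟨ψ', h'⟩ := ih'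
    exact ⟨.and φ' ψ', fun M s e => and_congr (h M s e) (h' M s e)⟩
  | all φ ih =>
    obtain ⟨φ', h⟩ := ih
    exact ⟨.all φ', fun M s e => forall₂_congr fun x _ => h M s _⟩

/-- The conjunction of a second-order formula with a first-order one can be brought into prenex
form without raising the level. -/
theorem HasLevel.exists_and {b : Side} {n k : ℕ} {φ : SOFormula k} (h : HasLevel b n φ) :
    ∀ {k' : ℕ} (f : Fin k → Fin k') (ψ : FOFormula k' 0), ∃ φ' : SOFormula k', HasLevel b n φ' ∧
      ∀ (M : ZFSet.{u}) s, φ'.Sat M s ↔ ψ.Sat M s Fin.elim0 ∧ φ.Sat M (s ∘ f) := by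
  have lift : ∀ {k k' : ℕ} (f : Fin k → Fin k') (X : Set ZFSet.{u}) (s : Fin k' → Set ZFSet.{u}),
      (Fin.cons X s : Fin (k' + 1) → Set ZFSet.{u}) ∘
        (Fin.cons 0 (Fin.succ ∘ f) : Fin (k + 1) → Fin (k' + 1)) = Fin.cons X (s ∘ f) :=
    fun f X s => funext fun i => Fin.cases rfl (fun _ => rfl) i
  have tail : ∀ {k' : ℕ} (X : Set ZFSet.{u}) (s : Fin k' → Set ZFSet.{u}),
      (Fin.cons X s : Fin (k' + 1) → Set ZFSet.{u}) ∘ Fin.succ = s := fun X s => rfl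
  induction h with
  | matrix φ =>
    intro k' f ψ
    obtain ⟨φ', h⟩ := φ.exists_rename.{u} f
    exact ⟨.matrix (.and ψ φ'), .matrix _, fun M s => and_congr_right fun _ => h M s _⟩
  | dual h ih =>
    intro k' f ψ
    obtain ⟨φ', h1, h2⟩ := ih f ψ
    exact ⟨φ', .dual h1, h2⟩
  | all h ih =>
    intro k' f ψ
    obtain ⟨ψ', hψ⟩ := ψ.exists_rename.{u} Fin.succ
    obtain ⟨φ', h1, h2⟩ := ih (Fin.cons 0 (Fin.succ ∘ f)) ψ'
    refine ⟨.all φ', .all h1, fun M s => ?_⟩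
    simp only [SOFormula.Sat, h2, hψ, lift, tail]
    exact ⟨fun H => ⟨(H ∅ (Set.empty_subset _)).1, fun X hX => (H X hX).2⟩,
      fun H X hX => ⟨H.1, H.2 X hX⟩⟩
  | ex h ih =>
    intro k' f ψ
    obtain ⟨ψ', hψ⟩ := ψ.exists_rename.{u} Fin.succ
    obtain ⟨φ', h1, h2⟩ := ih (Fin.cons 0 (Fin.succ ∘ f)) ψ'
    refine ⟨.ex φ', .ex h1, fun M s => ?_⟩
    simp only [SOFormula.Sat, h2, hψ, lift, tail]
    exact ⟨fun ⟨X, hX, H⟩ => ⟨H.1, X, hX, H.2⟩, fun ⟨H, X, hX, H'⟩ => ⟨X, hX, H, H'⟩⟩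

/-- The first-order matrix of a `Π¹₁` formula saying that the closure filter is proper. -/
def ProperMatrix (M : ZFSet.{u}) (s : Fin 2 → Set ZFSet.{u}) : Prop :=
  (∃ x ∈ M, x = x) ∧ (∀ x ∈ M, ∃ y ∈ M, x ∈ y) ∧ (IsTotal M (s 0) →
    ∃ d ∈ M, (∃ t ∈ M, (∃ x ∈ M, x ∈ t) ∧ ∃ q ∈ M, IsPair M q t d ∧ q ∈ s 1) ∧
      IsClosedIn M (s 0) d)

theorem FODef.properMatrix : FODef.{u} (m := 0) (fun M s _ => ProperMatrix M s) :=
  .and (.ex (.eq _ _)) (.and (.all (.ex (.mem _ _))) (.imp (.isTotal _) (.ex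
    (.and (.ex (.and (.ex (.mem _ _)) (.ex (.and (.isPair _ _ _) (.inSet _ _)))))
      (.isClosedIn _ _)))))

theorem neBot_clubFilter_iff {γ : Ordinal.{u}} : (clubFilter γ).NeBot ↔ IsSuccLimit γ ∧
    ∀ F ⊆ lv γ, RelClosed F γ → ∃ δ < γ, 0 < δ ∧ RelClosed F δ := by
  constructor
  · intro h
    have hγ := isSuccLimit_of_neBot (γ := γ)
    have := (frequently_clubFilter hγ (p := fun _ => True)).1 (frequently_true_iff_neBot _ |>.2 h)
    exact ⟨hγ, by simpa using this⟩
  · rintro ⟨hγ, h⟩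
    exact (frequently_true_iff_neBot _).1 ((frequently_clubFilter hγ).2 (by simpa using h))

theorem isSuccLimit_of_forall_mem {γ : Ordinal.{u}} (h0 : ∃ x, x ∈ V_ γ)
    (h1 : ∀ x ∈ V_ γ, ∃ y ∈ V_ γ, x ∈ y) : IsSuccLimit γ := by
  obtain ⟨x, hx⟩ := h0
  refine ⟨not_isMin_of_lt (mem_vonNeumann.1 hx), isSuccPrelimit_of_succ_lt fun α hα => ?_⟩
  obtain ⟨y, hy, h⟩ := h1 (V_ α) (vonNeumann_mem_lv.2 hα)
  have := rank_lt_of_mem h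
  rw [rank_vonNeumann] at this
  exact (succ_le_of_lt this).trans_lt (mem_lv.1 hy)

theorem forall_properMatrix_iff {γ : Ordinal.{u}} {N : ℕ}
    {E : Ordinal.{u} → List (Set ZFSet.{u}) → Prop} :
    (∀ F ⊆ lv γ, ProperMatrix (V_ γ) (Fin.cons F fun _ => codeSet N E ∩ lv γ)) ↔
      (clubFilter γ).NeBot := by
  rw [neBot_clubFilter_iff]
  constructor
  · intro h
    obtain ⟨⟨x, hx, -⟩, h1, -⟩ := h ∅ (Set.empty_subset _)
    have hγ := isSuccLimit_of_forall_mem ⟨x, hx⟩ h1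
    refine ⟨hγ, fun F hF hc => ?_⟩
    obtain ⟨d, hd, ⟨t, ht, ⟨x, -, hx⟩, q, hq, h2, h3⟩, h4⟩ := (h F hF).2.2 ((isTotal_iff hγ).2 hc)
    obtain ⟨δ, rfl⟩ := pair_mem_codeSet (fun h => notMem_empty x (h ▸ hx))
      (h2.eq_pair hq ht hd ▸ h3.1)
    have hδ := vonNeumann_mem_lv.1 hd
    exact ⟨δ, hδ, (isClosedIn_iff hγ hδ).1 h4⟩
  · rintro ⟨hγ, h⟩ F hF
    have h0 : (∅ : ZFSet.{u}) ∈ V_ γ := empty_mem_lv (bot_lt_iff_ne_bot.2 hγ.ne_bot)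
    have hs : ∀ x ∈ V_ γ, ({x} : ZFSet.{u}) ∈ V_ γ := fun x hx => by
      rw [mem_vonNeumann, rank_singleton]
      exact hγ.succ_lt (mem_lv.1 hx)
    refine ⟨⟨∅, h0, rfl⟩, fun x hx => ⟨{x}, hs x hx, mem_singleton.2 rfl⟩, fun hc => ?_⟩
    obtain ⟨δ, hδ, h1⟩ := h F hF ((isTotal_iff hγ).1 hc)
    have hd : V_ δ ∈ V_ γ := vonNeumann_mem_lv.2 hδ
    have hq := (pair_mem_lv hγ).2 ⟨hs ∅ h0, hd⟩
    exact ⟨_, hd, ⟨_, hs ∅ h0, ⟨∅, h0, mem_singleton.2 rfl⟩, _, hq,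
      (isPair_iff hq (hs ∅ h0) hd).2 rfl, .inr ⟨δ, rfl⟩, hq⟩, (isClosedIn_iff hγ hδ).2 h1⟩

/-- A `Π¹ₙ` normal form with `n ≥ 1`, together with the properness of the closure filter, is
expressed by a `Π¹ₙ` formula. -/
theorem exists_models_iff_nf {n : ℕ} (hn : n ≠ 0)
    (E : Ordinal.{u} → List (Set ZFSet.{u}) → Prop) : ∃ A φ, HasLevel .pi n φ ∧
      ∀ γ, Models γ A φ ↔ (clubFilter γ).NeBot ∧ Nf .pi n E γ [] := by
  obtain ⟨φ, -, h1, h2⟩ := exists_formula_nf.{u} .pi n 0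
  obtain ⟨E', hE⟩ := h2 E
  obtain ⟨ρ, hρ⟩ := FODef.properMatrix.{u}
  obtain ⟨φ', h3, h4⟩ := (h1 hn).exists_and.{u} (fun _ => (1 : Fin 2)) ρ
  refine ⟨codeSet n E', .all φ', ?_, fun γ => ?_⟩
  · obtain ⟨n, rfl⟩ := Nat.exists_eq_succ_of_ne_zero hn
    exact .all h3
  · have hφ : (clubFilter γ).NeBot →
        (φ.Sat (V_ γ) (fun _ => codeSet n E' ∩ lv γ) ↔ Nf .pi n E γ []) := fun hγ => by
      rw [← hE γ isSuccLimit_of_neBot [] rfl]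
      refine iff_of_eq (congrArg _ (funext fun i => ?_))
      obtain rfl : i = 0 := Subsingleton.elim (α := Fin 1) i 0
      rfl
    rw [← and_congr_right hφ, ← forall_properMatrix_iff (N := n) (E := E')]
    have : ∀ F, φ'.Sat (V_ γ) (Fin.cons F fun _ => codeSet n E' ∩ lv γ) ↔
        ProperMatrix (V_ γ) (Fin.cons F fun _ => codeSet n E' ∩ lv γ) ∧
          φ.Sat (V_ γ) (fun _ => codeSet n E' ∩ lv γ) := fun F =>
      (h4 _ _).trans (and_congr_left fun _ => hρ _ _ _)
    exact (forall₂_congr fun F _ => this F).trans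
      ⟨fun H => ⟨fun F hF => (H F hF).1, (H ∅ (Set.empty_subset _)).2⟩,
        fun H F hF => ⟨H.1 F hF, H.2⟩⟩

/-! ### Indescribable sets -/

theorem HasLevel.succ {b : Side} {n k : ℕ} {φ : SOFormula k} (h : HasLevel b n φ) :
    HasLevel b (n + 1) φ := by
  induction h with
  | matrix φ => exact .dual (.matrix φ)
  | dual _ ih => exact .dual ih
  | all _ ih => exact .all ih
  | ex _ ih => exact .ex ih

theorem IsIndescribable.of_succ {n : ℕ} {κ : Ordinal.{u}} {S : Set Ordinal.{u}}
    (h : IsIndescribable (n + 1) κ S) : IsIndescribable n κ S :=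
  ⟨h.1, fun A hA φ hφ => h.2 A hA φ hφ.succ⟩

theorem IsIndescribable.zero {n : ℕ} {κ : Ordinal.{u}} {S : Set Ordinal.{u}}
    (h : IsIndescribable n κ S) : IsIndescribable 0 κ S := by
  induction n with
  | zero => exact h
  | succ n ih => exact ih h.of_succ

theorem IsIndescribable.mono {n : ℕ} {κ : Ordinal.{u}} {S T : Set Ordinal.{u}}
    (h : IsIndescribable n κ S) (hST : S ⊆ T) (hT : T ⊆ Set.Iio κ) : IsIndescribable n κ T :=
  ⟨hT, fun A hA φ hφ hm => let ⟨α, hα, h'⟩ := h.2 A hA φ hφ hm; ⟨α, hST hα, h'⟩⟩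

theorem models_inter_lv {α β : Ordinal.{u}} (h : α ≤ β) (A : Set ZFSet.{u}) (φ : SOFormula 1) :
    Models α (A ∩ lv β) φ ↔ Models α A φ := by
  have : A ∩ lv β ∩ lv α = A ∩ lv α := inter_lv_inter_lv h A
  exact iff_of_eq (congrArg (fun X => φ.Sat (V_ α) fun _ => X) this)

theorem models_iff_env {γ : Ordinal.{u}} {A : Set ZFSet.{u}} {φ : SOFormula 1} :
    Models γ A φ ↔ φ.Sat (V_ γ) (env 1 (restr γ [A])) := by
  refine iff_of_eq (congrArg _ (funext fun i => ?_))
  rw [Subsingleton.elim i 0]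
  rfl

/-- A definable property of `(V_ κ, A)` reflects to a member of an indescribable set. -/
theorem IsIndescribable.exists_of_foDef {n : ℕ} {κ : Ordinal.{u}} {S : Set Ordinal.{u}}
    (h : IsIndescribable n κ S) {P : ZFSet.{u} → (Fin 1 → Set ZFSet.{u}) → Prop}
    (hP : FODef (m := 0) (fun M s _ => P M s)) {A : Set ZFSet.{u}} (hA : A ⊆ lv κ)
    (hm : P (V_ κ) fun _ => A) : ∃ α ∈ S, P (V_ α) fun _ => A ∩ lv α := by
  obtain ⟨φ, hφ⟩ := hP
  have key : ∀ α, Models α A (.matrix φ) ↔ P (V_ α) fun _ => A ∩ lv α := fun α => hφ _ _ _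
  obtain ⟨α, hα, h'⟩ := h.zero.2 A hA _ (.matrix φ)
    ((key κ).2 (by rwa [Set.inter_eq_left.2 hA]))
  exact ⟨α, hα, (key α).1 h'⟩

theorem IsIndescribable.neBot {n : ℕ} {κ : Ordinal.{u}} {S : Set Ordinal.{u}}
    (h : IsIndescribable n κ S) : (clubFilter κ).NeBot := by
  have h0 : 0 < κ := by
    obtain ⟨α, hα, -⟩ := h.exists_of_foDef (P := fun M _ => ∀ x ∈ M, x = x) (.all (.eq _ _))
      (Set.empty_subset _) fun _ _ => rfl
    exact zero_le.trans_lt (h.1 hα)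
  have hκ : IsSuccLimit κ := by
    refine ⟨not_isMin_of_lt h0, isSuccPrelimit_of_succ_lt fun α hα => ?_⟩
    obtain ⟨δ, hδ, x, hx, hxα⟩ := h.exists_of_foDef (P := fun M s => ∃ x ∈ M, x ∈ s 0)
      (.ex (.inSet _ _)) (A := {V_ α}) (by simpa using vonNeumann_mem_lv.2 hα)
      ⟨V_ α, vonNeumann_mem_lv.2 hα, rfl⟩
    obtain rfl : x = V_ α := hxα.1
    exact (succ_le_of_lt (vonNeumann_mem_lv.1 hx)).trans_lt (h.1 hδ)
  refine neBot_clubFilter_iff.2 ⟨hκ, fun F hF hc => ?_⟩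
  obtain ⟨δ, hδ, ⟨x, hx, -⟩, h1⟩ := h.exists_of_foDef
    (P := fun M s => (∃ x ∈ M, x = x) ∧ IsTotal M (s 0)) (.and (.ex (.eq _ _)) (.isTotal _)) hF
    ⟨⟨∅, empty_mem_lv h0, rfl⟩, (isTotal_iff hκ).2 hc⟩
  refine ⟨δ, h.1 hδ, zero_le.trans_lt (mem_vonNeumann.1 hx), fun y hy => ?_⟩
  obtain ⟨z, hz, h2⟩ := h1.isClosed y hy
  exact ⟨z, hz, h2.1⟩

/-- A member of a `Π¹ₙ`-indescribable set with `n ≥ 1` reflects any given `Π¹ₙ` normal form. -/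
theorem IsIndescribable.exists_of_semDef {n : ℕ} (hn : n ≠ 0) {κ : Ordinal.{u}}
    {S : Set Ordinal.{u}} (h : IsIndescribable n κ S)
    {P : Ordinal.{u} → List (Set ZFSet.{u}) → Prop} (hP : SemDef .pi n P) (hκ : P κ []) :
    ∃ γ ∈ S, (clubFilter γ).NeBot ∧ P γ [] := by
  obtain ⟨E, hE⟩ := hP
  obtain ⟨A, φ, hφ, hA⟩ := exists_models_iff_nf hn E
  have key : ∀ γ, Models γ A φ ↔ (clubFilter γ).NeBot ∧ P γ [] := fun γ =>
    (hA γ).trans (and_congr_right fun hγ => (hE γ hγ [] (by simp)).symm)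
  obtain ⟨γ, hγ, hm⟩ := h.2 (A ∩ lv κ) Set.inter_subset_right φ hφ
    ((models_inter_lv le_rfl A φ).2 ((key κ).2 ⟨h.neBot, hκ⟩))
  exact ⟨γ, hγ, (key γ).1 ((models_inter_lv (h.1 hγ).le A φ).1 hm)⟩

/-! ### Closure properties of normal forms -/

theorem HasLevel.semDef_models {n : ℕ} {φ : SOFormula 1} (h : HasLevel .pi n φ)
    (A : Set ZFSet.{u}) : SemDef .pi n (fun γ _ => Models γ A φ) := by
  obtain ⟨E, hE⟩ := h.semDef
  refine ⟨substAt n (fun δ _ => restr δ [A]) E, fun γ hγ s hs => ?_⟩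
  refine models_iff_env.trans ((hE γ hγ _ (by simp [restr])).trans (nf_substAt ?_).symm)
  filter_upwards [eventually_lt_self γ] with δ hδ
  simp [restr, inter_lv_inter_lv hδ.le]

/-- The ordinal represented by a set `Y`: the least `α` with `V_ α ∈ Y`, or `0` if there is none.
Every ordinal is represented by some set, and every set represents one. -/
noncomputable def leastRank (Y : Set ZFSet.{u}) : Ordinal.{u} := sInf {α | V_ α ∈ Y}

theorem leastRank_mem {Y : Set ZFSet.{u}} (h : ∃ α, V_ α ∈ Y) : V_ (leastRank Y) ∈ Y :=
  csInf_mem (s := {α | V_ α ∈ Y}) h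

theorem leastRank_of_not {Y : Set ZFSet.{u}} (h : ¬ ∃ α, V_ α ∈ Y) : leastRank Y = 0 := by
  have : {α | V_ α ∈ Y} = ∅ := Set.eq_empty_of_forall_notMem fun α hα => h ⟨α, hα⟩
  rw [leastRank, this, Ordinal.sInf_empty]

theorem leastRank_lt {γ : Ordinal.{u}} (hγ : 0 < γ) {Y : Set ZFSet.{u}} (hY : Y ⊆ lv γ) :
    leastRank Y < γ := by
  by_cases h : ∃ α, V_ α ∈ Y
  · exact vonNeumann_mem_lv.1 (hY (leastRank_mem h))
  · rwa [leastRank_of_not h]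

theorem leastRank_singleton (α : Ordinal.{u}) : leastRank {V_ α} = α := by
  have := leastRank_mem (Y := {V_ α}) ⟨α, rfl⟩
  simpa using this

theorem eventually_leastRank_inter {γ : Ordinal.{u}} (hγ : 0 < γ) {Y : Set ZFSet.{u}}
    (hY : Y ⊆ lv γ) : ∀ᶠ δ in clubFilter γ, leastRank (Y ∩ lv δ) = leastRank Y := by
  filter_upwards [eventually_gt (leastRank_lt hγ hY)] with δ hδ
  by_cases h : ∃ α, V_ α ∈ Y
  · have hm : V_ (leastRank Y) ∈ Y ∩ lv δ := ⟨leastRank_mem h, vonNeumann_mem_lv.2 hδ⟩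
    refine le_antisymm (csInf_le' hm) (le_csInf ⟨_, hm⟩ fun α hα => ?_)
    exact csInf_le' hα.1
  · rw [leastRank_of_not h, leastRank_of_not fun ⟨α, hα⟩ => h ⟨α, hα.1⟩]

/-- Diagonal intersections: the ordinal quantifier is absorbed by the leading set quantifier. -/
theorem SemDef.forall_lt {n : ℕ} {P : Ordinal.{u} → Ordinal.{u} → List (Set ZFSet.{u}) → Prop}
    (h : ∀ α, SemDef .pi (n + 1) (P α)) :
    SemDef .pi (n + 1) (fun γ s => ∀ α < γ, P α γ s) := by
  choose E hE using h
  -- `α` is represented by an additional set variable in front.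
  have key : SemDef .pi (n + 1) (fun γ s => P (leastRank (s.headD ∅)) γ s.tail) := by
    refine ⟨fun δ l => E (leastRank ((l.drop (n + 1)).headD ∅)) δ
      (l.take (n + 1) ++ (l.drop (n + 1)).tail), fun γ hγ s hs => ?_⟩
    have h0 : 0 < γ := bot_lt_iff_ne_bot.2 (isSuccLimit_of_neBot (γ := γ)).ne_bot
    have hY : s.headD ∅ ⊆ lv γ := by
      cases s with
      | nil => exact Set.empty_subset _
      | cons Y s => exact hs Y List.mem_cons_self
    refine (hE _ γ hγ _ fun X hX => hs X (List.mem_of_mem_tail hX)).trans (nf_congr ?_)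
    filter_upwards [eventually_leastRank_inter h0 hY] with δ hδ l hl
    have e1 : (restr δ s).headD ∅ = s.headD ∅ ∩ lv δ := by
      cases s <;> simp [restr]
    have e2 : (restr δ s).tail = restr δ s.tail := by
      cases s <;> rfl
    rw [List.take_left' hl, List.drop_left' hl, e1, e2, hδ]
  obtain ⟨E', hE'⟩ := key.forall
  refine ⟨E', fun γ hγ s hs => Iff.trans ?_ (hE' γ hγ s hs)⟩
  have h0 : 0 < γ := bot_lt_iff_ne_bot.2 (isSuccLimit_of_neBot (γ := γ)).ne_bot
  refine ⟨fun H Y hY => H _ (leastRank_lt h0 hY), fun H α hα => ?_⟩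
  have := H {V_ α} (by simpa using vonNeumann_mem_lv.2 hα)
  rwa [List.headD_cons, leastRank_singleton] at this

theorem SemDef.and {n : ℕ} {P Q : Ordinal.{u} → List (Set ZFSet.{u}) → Prop}
    (hP : SemDef .pi (n + 1) P) (hQ : SemDef .pi (n + 1) Q) :
    SemDef .pi (n + 1) (fun γ s => P γ s ∧ Q γ s) := by
  classical
  obtain ⟨E, hE⟩ := SemDef.forall_lt (P := fun α => if α = 0 then P else Q) fun α => by
    split_ifs
    exacts [hP, hQ]
  refine ⟨E, fun γ hγ s hs => Iff.trans ?_ (hE γ hγ s hs)⟩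
  have hγ' : IsSuccLimit γ := isSuccLimit_of_neBot
  have h0 : 0 < γ := bot_lt_iff_ne_bot.2 hγ'.ne_bot
  refine ⟨fun H α _ => ?_, fun H => ⟨by simpa using H 0 h0,
    by simpa using H (succ 0) (hγ'.succ_lt h0)⟩⟩
  split_ifs
  exacts [H.1, H.2]

/-- A condition on some `δ < γ` may be absorbed into the matrix of a normal form at `γ`. -/
theorem SemDef.or_exists_lt {b : Side} {n : ℕ} {P : Ordinal.{u} → List (Set ZFSet.{u}) → Prop}
    (hP : SemDef b n P) (G : Ordinal.{u} → List (Set ZFSet.{u}) → Prop) :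
    SemDef b n (fun γ s => P γ s ∨ ∃ δ < γ, G δ (restr δ s)) := by
  obtain ⟨E, hE⟩ := hP
  refine ⟨fun ε l => E ε l ∨ ∃ δ < ε, G δ (restr δ (l.drop n)), fun γ hγ s hs => ?_⟩
  dsimp only
  have hr : ∀ δ ε : Ordinal.{u}, δ < ε → restr δ (restr ε s) = restr δ s := fun δ ε h => by
    simp [restr, inter_lv_inter_lv h.le]
  by_cases H : ∃ δ < γ, G δ (restr δ s)
  · obtain ⟨δ, hδ, hG⟩ := H
    refine iff_of_true (.inr ⟨δ, hδ, hG⟩) ((nf_congr (t := s) ?_).2 ((nf_const True).2 trivial))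
    filter_upwards [eventually_gt hδ] with ε hε l hl
    refine iff_of_true (.inr ⟨δ, hε, ?_⟩) trivial
    rwa [List.drop_left' hl, hr δ ε hε]
  · rw [or_iff_left H, hE γ hγ s hs]
    refine nf_congr ?_
    filter_upwards [eventually_lt_self γ] with ε hε l hl
    refine (or_iff_left ?_).symm
    rintro ⟨δ, hδ, hG⟩
    rw [List.drop_left' hl, hr δ ε hδ] at hG
    exact H ⟨δ, hδ.trans hε, hG⟩

theorem SemDef.lt {b : Side} {n : ℕ} (α : Ordinal.{u}) : SemDef b n (fun γ _ => α < γ) := by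
  obtain ⟨E, hE⟩ := (SemDef.const (b := b) (n := n) False).or_exists_lt fun δ _ => δ = α
  refine ⟨E, fun γ hγ s hs => Iff.trans ?_ (hE γ hγ s hs)⟩
  simp

/-! ### Counting formulas -/

/-- An injective coding of first-order formulas by natural numbers. -/
def FOFormula.code {k : ℕ} : {m : ℕ} → FOFormula k m → ℕ
  | _, .eq i j => Nat.pair 0 (Nat.pair i j)
  | _, .mem i j => Nat.pair 1 (Nat.pair i j)
  | _, .inSet i X => Nat.pair 2 (Nat.pair i X)
  | _, .neg φ => Nat.pair 3 φ.code
  | _, .and φ ψ => Nat.pair 4 (Nat.pair φ.code ψ.code)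
  | _, .all φ => Nat.pair 5 φ.code

theorem FOFormula.code_injective {k m : ℕ} :
    Function.Injective (FOFormula.code : FOFormula k m → ℕ) := by
  intro φ ψ h
  induction φ with
  | eq i j => cases ψ <;> simp_all [FOFormula.code, Nat.pair_eq_pair, Fin.ext_iff]
  | mem i j => cases ψ <;> simp_all [FOFormula.code, Nat.pair_eq_pair, Fin.ext_iff]
  | inSet i X => cases ψ <;> simp_all [FOFormula.code, Nat.pair_eq_pair, Fin.ext_iff]
  | neg φ ih =>
    cases ψ <;> simp [FOFormula.code, Nat.pair_eq_pair] at h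
    rw [ih h]
  | and φ φ' ih ih' =>
    cases ψ <;> simp [FOFormula.code, Nat.pair_eq_pair] at h
    rw [ih h.1, ih' h.2]
  | all φ ih =>
    cases ψ <;> simp [FOFormula.code, Nat.pair_eq_pair] at h
    rw [ih h]

/-- An injective coding of second-order formulas by natural numbers. -/
def SOFormula.code : {k : ℕ} → SOFormula k → ℕ
  | _, .matrix φ => Nat.pair 0 φ.code
  | _, .all φ => Nat.pair 1 φ.code
  | _, .ex φ => Nat.pair 2 φ.code

theorem SOFormula.code_injective {k : ℕ} :
    Function.Injective (SOFormula.code : SOFormula k → ℕ) := by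
  intro φ ψ h
  induction φ with
  | matrix φ =>
    cases ψ <;> simp [SOFormula.code, Nat.pair_eq_pair] at h
    rw [FOFormula.code_injective h]
  | all φ ih =>
    cases ψ <;> simp [SOFormula.code, Nat.pair_eq_pair] at h
    rw [ih h]
  | ex φ ih =>
    cases ψ <;> simp [SOFormula.code, Nat.pair_eq_pair] at h
    rw [ih h]

/-- `Π¹ₘ`-indescribability is a `Π¹ₘ₊₁` property. The quantifier over formulas is one over natural
numbers, hence bounded by every limit ordinal; truth at smaller ordinals goes into the matrix. -/
theorem semDef_isIndescribable (m : ℕ) (C : Set Ordinal.{u}) :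
    SemDef .pi (m + 1) (fun γ _ => IsIndescribable m γ (C ∩ Set.Iio γ)) := by
  have hφ : ∀ φ : SOFormula 1, HasLevel .pi m φ → SemDef.{u} .pi (m + 1) (fun γ s =>
      ∀ X ⊆ lv γ, ¬ φ.Sat (V_ γ) (env 1 (X :: s)) ∨
        ∃ δ < γ, δ ∈ C ∧ φ.Sat (V_ δ) (env 1 (restr δ (X :: s)))) := fun φ h =>
    (h.semDef.not.or_exists_lt fun δ s => δ ∈ C ∧ φ.Sat (V_ δ) (env 1 s)).forall_of_sigma
  obtain ⟨E, hE⟩ := SemDef.forall_lt (n := m) (P := fun α γ s => ∀ φ : SOFormula 1,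
    HasLevel .pi m φ → (φ.code : Ordinal.{u}) = α →
      ∀ X ⊆ lv γ, ¬ φ.Sat (V_ γ) (env 1 (X :: s)) ∨
        ∃ δ < γ, δ ∈ C ∧ φ.Sat (V_ δ) (env 1 (restr δ (X :: s)))) fun α => by
    by_cases hα : ∃ φ : SOFormula 1, HasLevel .pi m φ ∧ (φ.code : Ordinal.{u}) = α
    · obtain ⟨φ, h, rfl⟩ := hα
      obtain ⟨E, hE⟩ := hφ φ h
      refine ⟨E, fun γ hγ s hs => Iff.trans ?_ (hE γ hγ s hs)⟩
      refine ⟨fun H => H φ h rfl, fun H ψ _ e => ?_⟩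
      rwa [SOFormula.code_injective (Nat.cast_injective e)]
    · obtain ⟨E, hE⟩ := SemDef.const (b := .pi) (n := m + 1) True
      refine ⟨E, fun γ hγ s hs => Iff.trans ?_ (hE γ hγ s hs)⟩
      exact iff_of_true (fun φ h e => (hα ⟨φ, h, e⟩).elim) trivial
  have henv : ∀ (X : Set ZFSet.{u}) (s : List (Set ZFSet.{u})), env 1 (X :: s) = env 1 [X] :=
    fun X s => funext fun i => by
      rw [Subsingleton.elim i 0]
      rfl
  refine ⟨E, fun γ hγ s hs => Iff.trans ?_ (hE γ hγ s hs)⟩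
  have hω : ∀ i : ℕ, (i : Ordinal.{u}) < γ := fun i =>
    (Ordinal.natCast_lt_omega0 i).trans_le (Ordinal.omega0_le_of_isSuccLimit isSuccLimit_of_neBot)
  have hmod : ∀ (δ : Ordinal.{u}) (φ : SOFormula 1) (X : Set ZFSet.{u}),
      φ.Sat (V_ δ) (env 1 (restr δ (X :: s))) ↔ Models δ X φ := fun δ φ X => by
    rw [models_iff_env]
    exact iff_of_eq (congrArg _ (henv _ _))
  have hmod' : ∀ (φ : SOFormula 1) (X : Set ZFSet.{u}), X ⊆ lv γ →
      (φ.Sat (V_ γ) (env 1 (X :: s)) ↔ Models γ X φ) := fun φ X hX => by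
    rw [models_iff_env, henv, restr, List.map_singleton, Set.inter_eq_left.2 hX]
  constructor
  · intro H α _ φ h _ X hX
    rw [hmod' φ X hX, ← imp_iff_not_or]
    intro hm
    obtain ⟨δ, hδ, hd⟩ := H.2 X hX φ h hm
    exact ⟨δ, hδ.2, hδ.1, (hmod δ φ X).2 hd⟩
  · refine fun H => ⟨Set.inter_subset_right, fun X hX φ h hm => ?_⟩
    obtain hn | ⟨δ, hδ, hC, hd⟩ := H _ (hω φ.code) φ h rfl X hX
    · exact (hn ((hmod' φ X hX).2 hm)).elim
    · exact ⟨δ, ⟨hC, hδ⟩, (hmod δ φ X).1 hd⟩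

/-! ### Splitting along a coherent sequence -/

/-- If a set of indices of a coherent sequence of `n`-clubs reflects to `β`, then one of the
members of that set has a club which is an initial segment of the club of `β`. -/
theorem IsCoherentSeq.exists_eq_inter {m : ℕ} {κ β : Ordinal.{u}}
    {C : Ordinal.{u} → Set Ordinal.{u}} (hC : IsCoherentSeq (m + 1) κ C) (hβ : β < κ)
    {S : Set Ordinal.{u}} (hS : S ⊆ predTrace (m + 1) κ)
    (h : IsIndescribable (m + 1) β (S ∩ Set.Iio β)) : ∃ γ ∈ S, C γ = C β ∩ Set.Iio γ := by
  have hβt : β ∈ predTrace (m + 1) κ := ⟨hβ, (h.mono Set.inter_subset_right subset_rfl).of_succ⟩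
  have hCβ : IsIndescribable m β (C β) := (hC.isNClub β hβt).1
  obtain ⟨γ, hγ, -, hr⟩ := h.exists_of_semDef (Nat.succ_ne_zero m)
    (semDef_isIndescribable m (C β)) (by rwa [Set.inter_eq_left.2 hCβ.1])
  exact ⟨γ, hγ.1, hC.coherent γ (hS hγ.1) β hβt hγ.2 hr⟩

/-- The indices `β > α` of the sequence `C` for which the truth value of `α ∈ C β` is `p`. -/
def splitPart (n : ℕ) (κ : Ordinal.{u}) (C : Ordinal.{u} → Set Ordinal.{u}) (α : Ordinal.{u})
    (p : Prop) : Set Ordinal.{u} :=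
  {β ∈ predTrace n κ | α < β ∧ (α ∈ C β ↔ p)}

theorem IsCoherentSeq.mem_iff_of_reflects {m : ℕ} {κ α β : Ordinal.{u}}
    {C : Ordinal.{u} → Set Ordinal.{u}} (hC : IsCoherentSeq (m + 1) κ C) (hβ : β < κ) {p : Prop}
    (h : IsIndescribable (m + 1) β (splitPart (m + 1) κ C α p ∩ Set.Iio β)) :
    α ∈ C β ↔ p := by
  obtain ⟨γ, ⟨-, hα, hp⟩, he⟩ := hC.exists_eq_inter hβ (Set.sep_subset _ _) h
  rw [← hp, he]
  exact (and_iff_left hα).symm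

/-- If every `α` decides by a set of measure one whether it belongs to `C β`, then the set of those
`α` for which it does is a thread. -/
theorem IsCoherentSeq.exists_isThread {m : ℕ} {κ : Ordinal.{u}}
    {C : Ordinal.{u} → Set Ordinal.{u}} (hκ : IsIndescribableCardinal (m + 1) κ)
    (hC : IsCoherentSeq (m + 1) κ C)
    (h : ∀ α < κ, ∃ p : Prop, ¬ IsIndescribable (m + 1) κ (splitPart (m + 1) κ C α p)) :
    ∃ D, IsThread (m + 1) κ C D := by
  -- Formulas witnessing that the parts in question are not indescribable.
  have hw : ∀ α, ∃ (p : Prop) (A : Set ZFSet.{u}) (φ : SOFormula 1), HasLevel .pi (m + 1) φ ∧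
      (α < κ → Models κ A φ ∧ ∀ β ∈ splitPart (m + 1) κ C α p, ¬ Models β A φ) := by
    intro α
    by_cases hα : α < κ
    · obtain ⟨p, hp⟩ := h α hα
      rw [IsIndescribable, not_and] at hp
      have := hp fun β hβ => hβ.1.1
      push Not at this
      obtain ⟨A, -, φ, h1, h2, h3⟩ := this
      exact ⟨p, A, φ, h1, fun _ => ⟨h2, h3⟩⟩
    · -- Any formula will do for the ordinals that are not below `κ`.
      have hl : HasLevel .pi (m + 1) (SOFormula.matrix (.all (.eq 0 0)) : SOFormula 1) := by
        clear * -
        induction m with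
        | zero => exact .dual (.matrix _)
        | succ m ih => exact ih.succ
      exact ⟨True, ∅, _, hl, fun h => (hα h).elim⟩
  choose p A φ hφ hw using hw
  let D : Set Ordinal.{u} := {α | α < κ ∧ ¬ p α}
  -- The set of `β` with `C β = D ∩ β` is of measure one.
  have hB : ∀ P : Ordinal.{u} → List (Set ZFSet.{u}) → Prop, SemDef .pi (m + 1) P → P κ [] →
      ∃ β ∈ predTrace (m + 1) κ, C β = D ∩ Set.Iio β ∧ P β [] := by
    intro P hP hPκ
    obtain ⟨β, hβ, -, ⟨h1, h2⟩, h3⟩ := IsIndescribable.exists_of_semDef (Nat.succ_ne_zero m) hκ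
      (((SemDef.forall_lt fun α => (hφ α).semDef_models (A α)).and
        (semDef_isIndescribable m Set.univ)).and hP)
      ⟨⟨fun α hα => (hw α hα).1, by simpa using hκ.of_succ⟩, hPκ⟩
    have hβt : β ∈ predTrace (m + 1) κ := ⟨hβ, by rwa [Set.univ_inter] at h2⟩
    refine ⟨β, hβt, ?_, h3⟩
    have hsub : C β ⊆ Set.Iio β := (hC.isNClub β hβt).1.1
    ext α
    have key : α < β → (α ∈ C β ↔ ¬ p α) := fun hα => by
      have : β ∉ splitPart (m + 1) κ C α (p α) :=
        fun hmem => (hw α (hα.trans hβ)).2 β hmem (h1 α hα)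
      have hn : ¬ (α ∈ C β ↔ p α) := fun hp => this ⟨hβt, hα, hp⟩
      tauto
    exact ⟨fun hα => ⟨⟨(hsub hα).trans hβ, (key (hsub hα)).1 hα⟩, hsub hα⟩,
      fun hα => (key hα.2).2 hα.1.2⟩
  have hB' : ∀ α < κ, ∃ β ∈ predTrace (m + 1) κ, α < β ∧ C β ⊆ D ∧
      C β ∩ Set.Iio α = D ∩ Set.Iio α := by
    intro α hα
    obtain ⟨β, hβ, h1, h2⟩ := hB _ (SemDef.lt α) hα
    refine ⟨β, hβ, h2, h1.subset.trans Set.inter_subset_left, ?_⟩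
    rw [h1, Set.inter_assoc, Set.inter_eq_right.2 (Set.Iio_subset_Iio h2.le)]
  refine ⟨D, ⟨⟨fun α hα => hα.1, fun X hX ψ hψ hm => ?_⟩, fun α hα hr => ?_⟩, fun α hα hr => ?_⟩
  · obtain ⟨β, hβ, h1, h2⟩ := hB _ (hψ.succ.semDef_models X) hm
    obtain ⟨γ, hγ, h3⟩ := (hC.isNClub β hβ).1.2 (X ∩ lv β) Set.inter_subset_right ψ hψ
      ((models_inter_lv le_rfl X ψ).2 h2)
    rw [h1] at hγ
    exact ⟨γ, hγ.1, (models_inter_lv (Set.mem_Iio.1 hγ.2).le X ψ).1 h3⟩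
  · obtain ⟨β, hβ, h1, h2, h3⟩ := hB' α hα
    rw [← h3] at hr
    exact h2 ((hC.isNClub β hβ).2 α h1 hr)
  · obtain ⟨β, hβ, h1, -, h2⟩ := hB' α hα.1
    rw [← h2] at hr ⊢
    exact hC.coherent α hα β hβ h1 hr

end Indescribable

theorem mainTheorem4 (n : ℕ) (hn : 1 ≤ n) (κ : Ordinal.{u})
    (hκ : Indescribable.IsIndescribableCardinal n κ) (hsq : Indescribable.Square n κ) :
    ∃ S₀ S₁ : Set Ordinal.{u}, S₀ ≠ S₁ ∧
      Indescribable.IsIndescribable n κ S₀ ∧ Indescribable.IsIndescribable n κ S₁ ∧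
      ¬ ∃ β < κ, Indescribable.IsIndescribable n β (S₀ ∩ Set.Iio β) ∧
        Indescribable.IsIndescribable n β (S₁ ∩ Set.Iio β) := by
  obtain ⟨m, rfl⟩ := Nat.exists_eq_add_of_le' hn
  obtain ⟨-, C, hC, hD⟩ := hsq
  by_cases h : ∀ α < κ, ∃ p : Prop, ¬ Indescribable.IsIndescribable (m + 1) κ
      (Indescribable.splitPart (m + 1) κ C α p)
  · exact (hD (hC.exists_isThread hκ h)).elim
  push Not at h
  obtain ⟨α, -, hα⟩ := h
  refine ⟨_, _, fun he => ?_, hα True, hα False, ?_⟩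
  · obtain ⟨β, hβ, -⟩ := (hα True).exists_of_semDef (Nat.succ_ne_zero m)
      (Indescribable.SemDef.const True) trivial
    have hβ' : β ∈ Indescribable.splitPart (m + 1) κ C α False := he ▸ hβ
    exact hβ'.2.2.1 (hβ.2.2.2 trivial)
  · rintro ⟨β, hβ, h0, h1⟩
    exact (hC.mem_iff_of_reflects hβ h1).1 ((hC.mem_iff_of_reflects hβ h0).2 trivial)
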